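/- Let $n\ge 0$, $m,p\ge 1$ be integers. Consider the system $\dot x(t)=Ax(t)+Bu(t)$, $y(t)=Cx(t)$, with $A\in\mathbb R^{n\times n}$, $B\in\mathbb R^{n\times m}$, $C\in\mathbb R^{p\times n}$, under static output feedback $u(t)=-Ky(t)$, $K\in\mathbb R^{m\times p}$, where $x(0)\sim\mathcal D$ for a probability distribution $\mathcal D$ on $\mathbb R^n$ such that $\mathbb E[x(0)x(0)^\top]\succ0$ and, for a constant $P>0$, $\|x(0)\|\le P$ almost surely. Let $Q\in\mathbb R^{p\times p}$ and $R\in\mathbb R^{m\times m}$ be symmetric positive definite, and let $$f(K)=\mathbb E_{x(0)\sim\mathcal D}\left[\int_0^\infty \bigl(y(t)^\top Qy(t)+u(t)^\top Ru(t)\bigr)\,dt\right].$$ For $a\in\mathbb R$ let $S(a)$ be the set of all $K\in\mathbb R^{m\times p}$ such that $A-BKC$ is Hurwitz and $f(K)\le a$. Given $K\in\mathbb R^{m\times p}$, $r>0$, $\tau>0$ and a positive integer $N$, draw $N$ independent pairs $(U_i,x_i(0))$, where $U_i$ is uniformly distributed on the sphere $\{U\in\mathbb R^{m\times p}:\|U\|_F=\sqrt{mp}\}$,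 $x_i(0)\sim\mathcal D$, and $U_i$ and $x_i(0)$ are independent. Let $c_i=\int_0^\tau\bigl(y_i(t)^\top Qy_i(t)+u_i(t)^\top Ru_i(t)\bigr)\,dt$ be the cost of the trajectory starting at $x_i(0)$ under the feedback $u_i=-(K+rU_i)y_i$, and put $$\hat\nabla f(K)=\frac1{rN}\sum_{i=1}^N c_iU_i .$$ **Theorem.** With $r=O(\varepsilon')$, $\tau=O(\log(1/\varepsilon'))$ and $N=O(\log(1/\delta)/\varepsilon'^4)$, the estimate is within $\varepsilon'$ of the gradient with probability greater than $1-\delta$, for each $K\in S(a)$. Precisely: there is a constant $\rho>0$ such that for every $c\in(0,\rho]$ there are constants $c_\tau,c_N>0$ ($\rho$ depending only on $A,B,C,Q,R,\mathcal D,P,a$, and $c_\tau,c_N$ only on these and $c$) with the following property. For all $\varepsilon'>0$ and $\delta>0$, all $r$ with $c\min(\varepsilon',1)\le r\le\rho\min(\varepsilon',1)$, all $\tau\ge c_\tau\max(\log(1/\varepsilon'),1)$, all integers $N\ge c_N\max(\log(1/\delta),1)/\min(\varepsilon',1)^4$ and all $K\in S(a)$, the function $f$ is differentiable at $K$ and $$\Pr\left(\bigl\|\hat\nabla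 f(K)-\nabla f(K)\bigr\|_F\le\varepsilon'\right)>1-\delta,$$ where $\nabla f$ is the gradient with respect to the Frobenius inner product. -/

import Mathlib

noncomputable section

namespace OutputFeedback

open MeasureTheory

/-- Feedback gains: real `m × p` matrices, as a Euclidean space under the Frobenius inner product
`⟪K, L⟫ = ∑ i j, K i j * L i j`; the norm of this space is the Frobenius norm. -/
abbrev Gain (m p : ℕ) : Type := EuclideanSpace ℝ (Fin m × Fin p)

/-- The matrix with the entries of the gain `K`. -/
def Gain.mat {m p : ℕ} (K : Gain m p) : Matrix (Fin m) (Fin p) ℝ :=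
  Matrix.of fun i j => K (i, j)

/-- The data of a continuous-time linear quadratic problem with output feedback: the system
`x' = A x + B u`, `y = C x` and the weights `Q`, `R` of the cost `∫ (yᵀ Q y + uᵀ R u) dt`. -/
structure LQProblem (n m p : ℕ) where
  A : Matrix (Fin n) (Fin n) ℝ
  B : Matrix (Fin n) (Fin m) ℝ
  C : Matrix (Fin p) (Fin n) ℝ
  Q : Matrix (Fin p) (Fin p) ℝ
  R : Matrix (Fin m) (Fin m) ℝ

/-- A real square matrix is Hurwitz if all its complex eigenvalues have negative real part. -/
def IsHurwitz {n : ℕ} (M : Matrix (Fin n) (Fin n) ℝ) : Prop :=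
  ∀ z ∈ spectrum ℂ (M.map (algebraMap ℝ ℂ)), z.re < 0

/-- The second moment matrix `E[x xᵀ]` of a distribution `D` on `ℝⁿ`. -/
def secondMoment {n : ℕ} (D : Measure (EuclideanSpace ℝ (Fin n))) : Matrix (Fin n) (Fin n) ℝ :=
  Matrix.of fun i j => ∫ x, x i * x j ∂D

/-- The uniform probability distribution on the sphere of gains of Frobenius norm `√(m p)`:
the normalized surface measure of the unit sphere, rescaled (for `m, p > 0`). -/
def uniformSphere (m p : ℕ) : Measure (Gain m p) :=
  Measure.map (fun v : Metric.sphere (0 : Gain m p) 1 => Real.sqrt (m * p) • (v : Gain m p))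
    (((volume : Measure (Gain m p)).toSphere Set.univ)⁻¹ • (volume : Measure (Gain m p)).toSphere)

namespace LQProblem

variable {n m p : ℕ} (S : LQProblem n m p)

/-- The closed-loop matrix `A - B K C` under the feedback `u = -K y`. -/
def closedLoop (K : Gain m p) : Matrix (Fin n) (Fin n) ℝ :=
  S.A - S.B * K.mat * S.C

/-- The state `x(t) = exp (t (A - B K C)) x₀` of the closed loop. -/
def state (K : Gain m p) (x₀ : EuclideanSpace ℝ (Fin n)) (t : ℝ) : Fin n → ℝ :=
  (NormedSpace.exp (t • S.closedLoop K)).mulVec x₀.ofLp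

/-- The output `y(t) = C x(t)`. -/
def output (K : Gain m p) (x₀ : EuclideanSpace ℝ (Fin n)) (t : ℝ) : Fin p → ℝ :=
  S.C.mulVec (S.state K x₀ t)

/-- The input `u(t) = -K y(t)`. -/
def input (K : Gain m p) (x₀ : EuclideanSpace ℝ (Fin n)) (t : ℝ) : Fin m → ℝ :=
  -(K.mat.mulVec (S.output K x₀ t))

theorem state_zero (K : Gain m p) (x₀ : EuclideanSpace ℝ (Fin n)) :
    S.state K x₀ 0 = x₀.ofLp := by
  simp [state]

/-- `state` solves `x' = A x + B u`. -/
theorem state_hasDerivAt (K : Gain m p) (x₀ : EuclideanSpace ℝ (Fin n)) (t : ℝ) :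
    HasDerivAt (S.state K x₀)
      (S.A.mulVec (S.state K x₀ t) + S.B.mulVec (S.input K x₀ t)) t := by
  let _ : NormedRing (Matrix (Fin n) (Fin n) ℝ) := Matrix.linftyOpNormedRing
  let _ : NormedAlgebra ℝ (Matrix (Fin n) (Fin n) ℝ) := Matrix.linftyOpNormedAlgebra
  have h := hasDerivAt_exp_smul_const' (𝕂 := ℝ) (S.closedLoop K) t
  let L : Matrix (Fin n) (Fin n) ℝ →ₗ[ℝ] (Fin n → ℝ) :=
    { toFun := fun M => M.mulVec x₀.ofLp
      map_add' := fun M N => Matrix.add_mulVec M N _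
      map_smul' := fun c M => Matrix.smul_mulVec c M _ }
  have h2 := (LinearMap.toContinuousLinearMap L).hasFDerivAt.comp_hasDerivAt t h
  have e : S.A.mulVec (S.state K x₀ t) + S.B.mulVec (S.input K x₀ t)
      = (S.closedLoop K * NormedSpace.exp (t • S.closedLoop K)).mulVec x₀.ofLp := by
    rw [← Matrix.mulVec_mulVec]
    change _ = (S.closedLoop K).mulVec (S.state K x₀ t)
    simp only [closedLoop, input, output, Matrix.mulVec_neg,
      Matrix.mulVec_mulVec, Matrix.mul_assoc, sub_eq_add_neg, Matrix.add_mulVec, Matrix.neg_mulVec]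
  rw [e]
  exact h2

/-- The running cost `y(t)ᵀ Q y(t) + u(t)ᵀ R u(t)`. -/
def runningCost (K : Gain m p) (x₀ : EuclideanSpace ℝ (Fin n)) (t : ℝ) : ℝ :=
  S.output K x₀ t ⬝ᵥ S.Q.mulVec (S.output K x₀ t) + S.input K x₀ t ⬝ᵥ S.R.mulVec (S.input K x₀ t)

/-- The objective `f(K)`: the expected infinite-horizon cost for `x(0) ∼ D`. -/
def cost (D : Measure (EuclideanSpace ℝ (Fin n))) (K : Gain m p) : ℝ :=
  ∫ x₀, (∫ t in Set.Ioi (0 : ℝ), S.runningCost K x₀ t) ∂D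

/-- The cost of the trajectory from `x₀`, simulated until time `τ`. -/
def simulatedCost (τ : ℝ) (K : Gain m p) (x₀ : EuclideanSpace ℝ (Fin n)) : ℝ :=
  ∫ t in (0 : ℝ)..τ, S.runningCost K x₀ t

/-- The sublevel set: stabilizing gains `K` with `f(K) ≤ a`. -/
def sublevel (D : Measure (EuclideanSpace ℝ (Fin n))) (a : ℝ) : Set (Gain m p) :=
  {K | IsHurwitz (S.closedLoop K) ∧ S.cost D K ≤ a}

/-- The gradient estimate `(1 / (r N)) ∑ i, cᵢ Uᵢ` from the samples `ω i = (Uᵢ, xᵢ(0))`, where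
`cᵢ` is the cost of the gain `K + r Uᵢ` from `xᵢ(0)`, simulated until time `τ`. -/
def gradEstimate (r τ : ℝ) {N : ℕ} (K : Gain m p)
    (ω : Fin N → Gain m p × EuclideanSpace ℝ (Fin n)) : Gain m p :=
  (1 / (r * N)) • ∑ i, S.simulatedCost τ (K + r • (ω i).1) (ω i).2 • (ω i).1

end LQProblem

/-- The law of the `N` independent samples `(Uᵢ, xᵢ(0))`, where `Uᵢ` is uniform on the sphere of
radius `√(m p)`, `xᵢ(0) ∼ D`, and `Uᵢ` and `xᵢ(0)` are independent. -/
def sampleLaw {n : ℕ} (m p : ℕ) (D : Measure (EuclideanSpace ℝ (Fin n))) (N : ℕ) :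
    Measure (Fin N → Gain m p × EuclideanSpace ℝ (Fin n)) :=
  Measure.pi fun _ => (uniformSphere m p).prod D

end OutputFeedback

end

/-!
Write `G = K C`, `M = A - B G`, `W = Cᵀ Q C + Gᵀ R G`. For stabilizing `K` the cost from `x` is
`xᵀ X x` with `X = ∫₀^∞ exp (t Mᵀ) W exp (t M) dt`, so that `f(K) = E[xᵀ X x]` is linear in `X`,
and `X` solves the Lyapunov equation `Mᵀ X + X M = -W`. The proof has a deterministic and a
probabilistic half.

**Uniform stability.** The sublevel set `S(a)` need not be bounded, since `K` enters only through
`K C`, and no observability of `(A, C)` is assumed; all constants are therefore expressed through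
`K C` and the closed loop. As the second moment matrix, `Q` and `R` are positive definite,
`f(K) ≤ a` bounds the energies `∫ ‖C exp (t M)‖²` and `∫ ‖G exp (t M)‖²`
(`LQProblem.exists_integral_output_input_le`). The second energy is at least a constant times
`‖G‖² / (1 + ‖M‖)`, which bounds `G` (`LQProblem.exists_norm_mat_mul_le`). Any fixed `K₀ ∈ S(a)`
yields an observer gain `B K₀`, and its Lyapunov function bounds `∫ ‖exp (t M)‖²`
(`LQProblem.exists_integral_sq_norm_exp_le`). A quantitative form of Datko's theorem turns this
into one exponential rate for all closed loops on `S(a)` and for their perturbations of a fixed size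
(`LQProblem.exists_uniform_decays`).

**Expansion of the cost.** Perturbing the Lyapunov equation gives
`|f(K + H) - f(K) - ⟪∇f(K), H⟫| ≤ L ‖H‖²` for small `H`, with `L` and the range of `H` uniform on
`S(a)` (`LQProblem.exists_cost_expansion`). Truncation at time `τ` costs `O(exp (-β τ))`
(`LQProblem.exists_simulatedCost_bounds`).

**Sampling.** By invariance of the surface measure under isometries, `U` has mean zero and identity
covariance. Hence the bias of the estimate comes only from the remainder of the expansion and from
truncation, and it is `O(r + exp (-β τ) / r)` (`LQProblem.abs_integral_sampleCoord_sub_le`). Each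
sample is bounded by `O(1 / r)`, so Hoeffding's inequality in every coordinate, with deviation of
order `ε` and `r` of order `ε`, gives the failure probability `O(exp (-λ N ε⁴))`
(`LQProblem.measureReal_lt_norm_gradEstimate_sub_le`).
-/

noncomputable section

namespace OutputFeedback

open MeasureTheory Set Filter Topology
open NormedSpace (exp)

/-! ### Semigroups and Sylvester integrals in a normed algebra -/

section Algebra

variable {𝔸 : Type*} [NormedRing 𝔸] [NormedAlgebra ℝ 𝔸]

/-- `Decays κ γ M` says that the semigroup of `M` satisfies `‖exp (t M)‖ ≤ κ exp (-γ t)` for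
all `t ≥ 0`. -/
def Decays (κ γ : ℝ) (M : 𝔸) : Prop :=
  ∀ t : ℝ, 0 ≤ t → ‖exp (t • M)‖ ≤ κ * Real.exp (-(γ * t))

theorem Decays.norm_exp_mul_mul_exp_le {κ γ : ℝ} {N M : 𝔸} (hN : Decays κ γ N)
    (hM : Decays κ γ M) (Y : 𝔸) {t : ℝ} (ht : 0 ≤ t) :
    ‖exp (t • N) * Y * exp (t • M)‖ ≤ κ ^ 2 * ‖Y‖ * Real.exp (-(2 * γ) * t) := by
  have h1 := hN t ht
  have h2 := hM t ht
  have e : Real.exp (-(2 * γ) * t) = Real.exp (-(γ * t)) * Real.exp (-(γ * t)) := by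
    rw [← Real.exp_add]; ring_nf
  calc ‖exp (t • N) * Y * exp (t • M)‖ ≤ ‖exp (t • N)‖ * ‖Y‖ * ‖exp (t • M)‖ :=
        (norm_mul_le _ _).trans (mul_le_mul_of_nonneg_right (norm_mul_le _ _) (norm_nonneg _))
    _ ≤ (κ * Real.exp (-(γ * t))) * ‖Y‖ * (κ * Real.exp (-(γ * t))) := by
        have := (norm_nonneg _).trans h1
        gcongr
    _ = _ := by rw [e]; ring

/-- The integral `∫₀^∞ exp (t N) Y exp (t M) dt`, which solves the Sylvester equation
`N X + X M = -Y` when the semigroups of `N` and `M` decay. -/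
def sylv (N M Y : 𝔸) : 𝔸 := ∫ t in Ioi (0 : ℝ), exp (t • N) * Y * exp (t • M)

theorem sylv_smul (c : ℝ) (N M Y : 𝔸) : sylv N M (c • Y) = c • sylv N M Y := by
  simp only [sylv, mul_smul_comm, smul_mul_assoc]
  exact integral_smul _ _

theorem sylv_neg (N M Y : 𝔸) : sylv N M (-Y) = -sylv N M Y := by
  simpa using sylv_smul (-1) N M Y

theorem Decays.norm_setIntegral_Ioi_le {κ γ : ℝ} {N M : 𝔸} (hγ : 0 < γ) (hN : Decays κ γ N)
    (hM : Decays κ γ M) (Y : 𝔸) {τ : ℝ} (hτ : 0 ≤ τ) :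
    ‖∫ t in Ioi τ, exp (t • N) * Y * exp (t • M)‖ ≤
      κ ^ 2 / (2 * γ) * ‖Y‖ * Real.exp (-(2 * γ) * τ) := by
  have h := norm_integral_le_of_norm_le
    ((integrableOn_exp_mul_Ioi (a := -(2 * γ)) (by linarith) τ).const_mul (κ ^ 2 * ‖Y‖))
    ((ae_restrict_iff' measurableSet_Ioi).2 (ae_of_all _ fun t ht =>
      hN.norm_exp_mul_mul_exp_le hM Y (hτ.trans (le_of_lt ht))))
  refine h.trans (le_of_eq ?_)
  rw [integral_const_mul, integral_exp_mul_Ioi (by linarith) τ]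
  field_simp

theorem Decays.norm_sylv_le {κ γ : ℝ} {N M : 𝔸} (hγ : 0 < γ) (hN : Decays κ γ N)
    (hM : Decays κ γ M) (Y : 𝔸) :
    ‖sylv N M Y‖ ≤ κ ^ 2 / (2 * γ) * ‖Y‖ := by
  simpa [sylv] using hN.norm_setIntegral_Ioi_le hγ hM Y le_rfl

variable [ProperSpace 𝔸]

theorem continuous_exp_algebra : Continuous (exp : 𝔸 → 𝔸) := by
  let _ : NormedAlgebra ℚ 𝔸 := NormedAlgebra.restrictScalars ℚ ℝ 𝔸
  exact NormedSpace.exp_continuous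

theorem continuous_exp_smul (M : 𝔸) : Continuous fun t : ℝ => exp (t • M) :=
  continuous_exp_algebra.comp (by fun_prop)

theorem exp_add_smul (s t : ℝ) (M : 𝔸) : exp ((s + t) • M) = exp (s • M) * exp (t • M) := by
  let _ : NormedAlgebra ℚ 𝔸 := NormedAlgebra.restrictScalars ℚ ℝ 𝔸
  rw [add_smul]
  exact NormedSpace.exp_add_of_commute (((Commute.refl M).smul_left s).smul_right t)

theorem exp_nat_mul_smul (k : ℕ) (t : ℝ) (M : 𝔸) : exp ((k * t : ℝ) • M) = exp (t • M) ^ k := by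
  let _ : NormedAlgebra ℚ 𝔸 := NormedAlgebra.restrictScalars ℚ ℝ 𝔸
  rw [← NormedSpace.exp_nsmul, mul_smul, Nat.cast_smul_eq_nsmul]

theorem exists_norm_exp_le (b : ℝ) : ∃ C : ℝ, 1 ≤ C ∧ ∀ M : 𝔸, ‖M‖ ≤ b → ‖exp M‖ ≤ C := by
  obtain ⟨C, hC⟩ := (isCompact_closedBall (0 : 𝔸) b).exists_bound_of_continuousOn
    continuous_exp_algebra.continuousOn
  exact ⟨max C 1, le_max_right _ _, fun M hM => (hC M (by simpa using hM)).trans (le_max_left _ _)⟩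

/-- A contraction at one time `T` gives exponential decay, with constants that depend only on `T`
and a bound for the generator. -/
theorem exists_decays_of_norm_exp_le (b T : ℝ) (hT : 0 < T) :
    ∃ κ γ : ℝ, 0 < κ ∧ 0 < γ ∧ ∀ M : 𝔸, ‖M‖ ≤ b → ‖exp (T • M)‖ ≤ 3 / 4 → Decays κ γ M := by
  obtain ⟨C, hC1, hC⟩ := exists_norm_exp_le (𝔸 := 𝔸) (T * b)
  have hlog : 0 < Real.log (4 / 3) := Real.log_pos (by norm_num)
  -- With `k = ⌊t / T⌋` the norm is at most `C (3 / 4)^k`; the factor `4 / 3` makes up for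
  -- `t / T < k + 1`.
  refine ⟨C * (4 / 3), Real.log (4 / 3) / T, by positivity, by positivity, fun M hM hMT t ht => ?_⟩
  set k := ⌊t / T⌋₊
  have hk : (k : ℝ) * T ≤ t := (le_div_iff₀ hT).1 (Nat.floor_le (by positivity))
  have hk2 : t < (k + 1) * T := (div_lt_iff₀ hT).1 (Nat.lt_floor_add_one _)
  have h1 : ‖exp ((t - k * T) • M)‖ ≤ C := by
    apply hC
    rw [norm_smul, Real.norm_of_nonneg (by linarith)]
    exact mul_le_mul (by linarith) hM (norm_nonneg _) hT.le
  have h2 : exp (t • M) = exp ((t - k * T) • M) * exp (T • M) ^ k := by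
    rw [← exp_nat_mul_smul, ← exp_add_smul]; congr 2; ring
  have h3 : ‖exp (t • M)‖ ≤ C * (3 / 4) ^ k := by
    rw [h2]
    rcases Nat.eq_zero_or_pos k with h0 | h0
    · simpa [h0] using h1
    · refine (norm_mul_le _ _).trans (mul_le_mul h1 ((norm_pow_le' _ h0).trans ?_)
        (norm_nonneg _) (by linarith))
      exact pow_le_pow_left₀ (norm_nonneg _) hMT k
  refine h3.trans ?_
  rw [mul_assoc]
  refine mul_le_mul_of_nonneg_left ?_ (by linarith)
  have e1 : ((3 : ℝ) / 4) ^ k = Real.exp (-(k * Real.log (4 / 3))) := by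
    rw [Real.exp_neg, mul_comm, Real.exp_mul, Real.exp_log (by norm_num), Real.rpow_natCast,
      ← inv_pow]
    norm_num
  rw [e1]
  nth_rewrite 2 [← Real.exp_log (show (0 : ℝ) < 4 / 3 by norm_num)]
  rw [← Real.exp_add, Real.exp_le_exp]
  have : Real.log (4 / 3) / T * t ≤ Real.log (4 / 3) * (k + 1) := by
    rw [div_mul_eq_mul_div, div_le_iff₀ hT, mul_assoc]
    exact mul_le_mul_of_nonneg_left hk2.le hlog.le
  linarith

/-- Datko's theorem with explicit dependence: a bound for the generator and for the square
integral of its semigroup determines a time at which the semigroup is a contraction. -/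
theorem exists_norm_exp_le_half_of_integral_le (b J : ℝ) (hJ : 0 ≤ J) :
    ∃ T : ℝ, 0 < T ∧ ∀ M : 𝔸, ‖M‖ ≤ b → IntegrableOn (fun t : ℝ => ‖exp (t • M)‖ ^ 2) (Ioi 0) →
      ∫ t in Ioi (0 : ℝ), ‖exp (t • M)‖ ^ 2 ≤ J → ‖exp (T • M)‖ ≤ 1 / 2 := by
  obtain ⟨C, hC1, hC⟩ := exists_norm_exp_le (𝔸 := 𝔸) b
  -- `D` bounds `‖exp (t M)‖²` for all `t ≥ 0`.
  set D := C ^ 2 * (J + 1) with hD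
  have hD0 : 0 < D := by positivity
  refine ⟨4 * (D * J) + 1, by positivity, fun M hM hint hle => ?_⟩
  have hcont := continuous_exp_smul M
  have key : ∀ u v : ℝ, 0 ≤ u → u ≤ v → ∫ t in u..v, ‖exp (t • M)‖ ^ 2 ≤ J := by
    intro u v hu huv
    rw [intervalIntegral.integral_of_le huv]
    refine (setIntegral_mono_set hint (ae_of_all _ fun _ => by positivity) ?_).trans hle
    exact (Ioc_subset_Ioi_self.trans (Ioi_subset_Ioi hu)).eventuallyLE
  have hshort : ∀ s : ℝ, 0 ≤ s → s ≤ 1 → ‖exp (s • M)‖ ≤ C := fun s h0 h1 => by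
    apply hC
    rw [norm_smul, Real.norm_of_nonneg h0]
    nlinarith [norm_nonneg M]
  have hbd : ∀ t : ℝ, 0 ≤ t → ‖exp (t • M)‖ ^ 2 ≤ D := by
    intro t ht
    rcases le_or_gt t 1 with h | h
    · have := pow_le_pow_left₀ (norm_nonneg _) (hshort t ht h) 2
      nlinarith [sq_nonneg C]
    -- For `t > 1`, the value at `t` is compared with the integral over `[t - 1, t]`.
    · have h1 : ∫ s in (t - 1)..t, ‖exp (t • M)‖ ^ 2 ≤
          ∫ s in (t - 1)..t, C ^ 2 * ‖exp (s • M)‖ ^ 2 := by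
        apply intervalIntegral.integral_mono_on (by linarith)
        · exact continuous_const.intervalIntegrable _ _
        · exact (Continuous.intervalIntegrable (by fun_prop) _ _)
        · intro s hs
          rw [← mul_pow]
          refine pow_le_pow_left₀ (norm_nonneg _) ?_ 2
          have : exp (t • M) = exp ((t - s) • M) * exp (s • M) := by
            rw [← exp_add_smul]; congr 2; ring
          rw [this]
          exact (norm_mul_le _ _).trans (mul_le_mul_of_nonneg_right
            (hshort _ (by linarith [hs.2]) (by linarith [hs.1])) (norm_nonneg _))
      rw [intervalIntegral.integral_const, intervalIntegral.integral_const_mul] at h1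
      simp only [sub_sub_cancel, one_smul] at h1
      have h2 := key (t - 1) t (by linarith) (by linarith)
      nlinarith [sq_nonneg C]
  -- Integrating `‖exp (T M)‖² ≤ D ‖exp (s M)‖²` over `s ∈ [0, T]` gives `T ‖exp (T M)‖² ≤ D J`.
  set T := 4 * (D * J) + 1 with hT
  have hT0 : 0 < T := by positivity
  have h1 : ∫ s in (0 : ℝ)..T, ‖exp (T • M)‖ ^ 2 ≤ ∫ s in (0 : ℝ)..T, D * ‖exp (s • M)‖ ^ 2 := by
    apply intervalIntegral.integral_mono_on hT0.le
    · exact continuous_const.intervalIntegrable _ _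
    · exact (Continuous.intervalIntegrable (by fun_prop) _ _)
    · intro s hs
      have : exp (T • M) = exp ((T - s) • M) * exp (s • M) := by
        rw [← exp_add_smul]; congr 2; ring
      calc ‖exp (T • M)‖ ^ 2 ≤ (‖exp ((T - s) • M)‖ * ‖exp (s • M)‖) ^ 2 := by
            rw [this]; exact pow_le_pow_left₀ (norm_nonneg _) (norm_mul_le _ _) 2
        _ ≤ _ := by
            rw [mul_pow]
            exact mul_le_mul_of_nonneg_right (hbd _ (by linarith [hs.2])) (by positivity)
  rw [intervalIntegral.integral_const, intervalIntegral.integral_const_mul] at h1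
  simp only [sub_zero, smul_eq_mul] at h1
  have h2 := key 0 T le_rfl hT0.le
  have h3 : T * ‖exp (T • M)‖ ^ 2 ≤ D * J := h1.trans (mul_le_mul_of_nonneg_left h2 hD0.le)
  have h4 : ‖exp (T • M)‖ ^ 2 ≤ (1 / 2) ^ 2 := by
    by_contra hcon
    push Not at hcon
    nlinarith
  exact le_of_sq_le_sq h4 (by norm_num)

theorem exists_norm_exp_add_le (b T : ℝ) : ∃ η : ℝ, 0 < η ∧ ∀ M Δ : 𝔸, ‖M‖ ≤ b → ‖Δ‖ ≤ η →
    ‖exp (T • M)‖ ≤ 1 / 2 → ‖exp (T • (M + Δ))‖ ≤ 3 / 4 := by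
  have huc := (isCompact_closedBall (0 : 𝔸) (b + 1)).uniformContinuousOn_of_continuous
    (f := fun M : 𝔸 => exp (T • M)) (continuous_exp_algebra.comp (by fun_prop)).continuousOn
  obtain ⟨δ, hδ, h⟩ := Metric.uniformContinuousOn_iff.1 huc (1 / 4) (by norm_num)
  refine ⟨min (δ / 2) 1, by positivity, fun M Δ hM hΔ hT => ?_⟩
  have h1 : ‖M + Δ‖ ≤ b + 1 := (norm_add_le _ _).trans (add_le_add hM (hΔ.trans (min_le_right _ _)))
  have := h (M + Δ) (by simpa using h1) M (by simpa using hM.trans (by linarith)) (by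
    rw [dist_eq_norm, add_sub_cancel_left]
    exact lt_of_le_of_lt (hΔ.trans (min_le_left _ _)) (by linarith))
  rw [dist_eq_norm] at this
  have h3 := norm_le_norm_add_norm_sub' (exp (T • (M + Δ))) (exp (T • M))
  linarith

/-- Generators of bounded norm whose semigroups have bounded square integrals decay at a common
exponential rate, and so do their small perturbations. -/
theorem exists_decays_add (b J : ℝ) (hJ : 0 ≤ J) : ∃ η κ γ : ℝ, 0 < η ∧ 0 < κ ∧ 0 < γ ∧
    ∀ M : 𝔸, ‖M‖ ≤ b → IntegrableOn (fun t : ℝ => ‖exp (t • M)‖ ^ 2) (Ioi 0) →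
      ∫ t in Ioi (0 : ℝ), ‖exp (t • M)‖ ^ 2 ≤ J →
      ∀ Δ : 𝔸, ‖Δ‖ ≤ η → Decays κ γ (M + Δ) := by
  obtain ⟨T, hT, h1⟩ := exists_norm_exp_le_half_of_integral_le (𝔸 := 𝔸) b J hJ
  obtain ⟨η, hη, h2⟩ := exists_norm_exp_add_le (𝔸 := 𝔸) b T
  obtain ⟨κ, γ, hκ, hγ, h3⟩ := exists_decays_of_norm_exp_le (𝔸 := 𝔸) (b + η) T hT
  exact ⟨η, κ, γ, hη, hκ, hγ, fun M hM hi hle Δ hΔ =>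
    h3 _ ((norm_add_le _ _).trans (add_le_add hM hΔ)) (h2 M Δ hM hΔ (h1 M hM hi hle))⟩

section Sylvester

variable {κ γ : ℝ} {N M : 𝔸}

theorem continuous_exp_mul_mul_exp (N M Y : 𝔸) :
    Continuous fun t : ℝ => exp (t • N) * Y * exp (t • M) :=
  ((continuous_exp_smul N).mul continuous_const).mul (continuous_exp_smul M)

theorem Decays.integrableOn (hγ : 0 < γ) (hN : Decays κ γ N) (hM : Decays κ γ M) (Y : 𝔸) :
    IntegrableOn (fun t : ℝ => exp (t • N) * Y * exp (t • M)) (Ioi 0) := by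
  refine Integrable.mono' ((integrableOn_exp_mul_Ioi (a := -(2 * γ)) (by linarith) 0).const_mul
    (κ ^ 2 * ‖Y‖)) (continuous_exp_mul_mul_exp N M Y).aestronglyMeasurable ?_
  exact (ae_restrict_iff' measurableSet_Ioi).2 (ae_of_all _ fun t ht =>
    hN.norm_exp_mul_mul_exp_le hM Y (le_of_lt ht))

theorem Decays.norm_intervalIntegral_sub_sylv_le (hγ : 0 < γ) (hN : Decays κ γ N)
    (hM : Decays κ γ M) (Y : 𝔸) {τ : ℝ} (hτ : 0 ≤ τ) :
    ‖(∫ t in (0 : ℝ)..τ, exp (t • N) * Y * exp (t • M)) - sylv N M Y‖ ≤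
      κ ^ 2 / (2 * γ) * ‖Y‖ * Real.exp (-(2 * γ) * τ) := by
  have h := intervalIntegral.integral_Ioi_sub_Ioi (hN.integrableOn hγ hM Y) hτ
  have h2 := hN.norm_setIntegral_Ioi_le hγ hM Y hτ
  rw [← h]
  simp only [sylv, sub_sub_cancel_left, norm_neg]
  exact h2

theorem Decays.sylv_add (hγ : 0 < γ) (hN : Decays κ γ N) (hM : Decays κ γ M) (Y Z : 𝔸) :
    sylv N M (Y + Z) = sylv N M Y + sylv N M Z := by
  simp only [sylv, mul_add, add_mul]
  exact integral_add (hN.integrableOn hγ hM Y) (hN.integrableOn hγ hM Z)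

theorem hasDerivAt_exp_mul_mul_exp (N M Y : 𝔸) (t : ℝ) :
    HasDerivAt (fun t : ℝ => exp (t • N) * Y * exp (t • M))
      (exp (t • N) * (N * Y + Y * M) * exp (t • M)) t := by
  have h1 := hasDerivAt_exp_smul_const (𝕂 := ℝ) N t
  have h2 := hasDerivAt_exp_smul_const' (𝕂 := ℝ) M t
  refine ((h1.mul_const Y).mul h2).congr_deriv ?_
  simp only [mul_add, add_mul, mul_assoc]

theorem Decays.sylv_mul_add_mul (hγ : 0 < γ) (hN : Decays κ γ N) (hM : Decays κ γ M) (Y : 𝔸) :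
    sylv N M (N * Y + Y * M) = -Y := by
  have h := integral_Ioi_of_hasDerivAt_of_tendsto' (a := 0)
    (fun t _ => hasDerivAt_exp_mul_mul_exp N M Y t)
    (hN.integrableOn hγ hM (N * Y + Y * M)) (m := 0) (by
      refine squeeze_zero_norm' ((eventually_ge_atTop (0 : ℝ)).mono fun t ht =>
        hN.norm_exp_mul_mul_exp_le hM Y ht) ?_
      rw [← mul_zero (κ ^ 2 * ‖Y‖)]
      refine (Real.tendsto_exp_atBot.comp ?_).const_mul _
      exact tendsto_id.const_mul_atTop_of_neg (by linarith))
  simpa [sylv] using h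

theorem Decays.mul_sylv_add_sylv_mul (hγ : 0 < γ) (hN : Decays κ γ N) (hM : Decays κ γ M)
    (Y : 𝔸) : N * sylv N M Y + sylv N M Y * M = -Y := by
  rw [← hN.sylv_mul_add_mul hγ hM Y, hN.sylv_add hγ hM]
  have hi := hN.integrableOn hγ hM Y
  have comm : ∀ (L : 𝔸) (t : ℝ), exp (t • L) * L = L * exp (t • L) := fun L t =>
    ((hasDerivAt_exp_smul_const (𝕂 := ℝ) L t).unique (hasDerivAt_exp_smul_const' (𝕂 := ℝ) L t))
  congr 1
  · simp only [sylv]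
    rw [← integral_const_mul_of_integrable hi]
    congr 1; ext t
    rw [← mul_assoc, ← mul_assoc, ← mul_assoc, comm]
  · simp only [sylv]
    rw [← integral_mul_const_of_integrable hi]
    congr 1; ext t
    rw [mul_assoc, mul_assoc, mul_assoc, mul_assoc, comm]

/-- The Sylvester integral under a perturbation of all its data. -/
theorem Decays.sylv_sub_sylv (hγ : 0 < γ) (hN : Decays κ γ N) (hM : Decays κ γ M) {dN dM : 𝔸}
    (hN' : Decays κ γ (N + dN)) (hM' : Decays κ γ (M + dM)) (W W' : 𝔸) :
    sylv (N + dN) (M + dM) W' - sylv N M W =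
      sylv N M (W' - W + dN * sylv (N + dN) (M + dM) W' + sylv (N + dN) (M + dM) W' * dM) := by
  set X' := sylv (N + dN) (M + dM) W' with hX'
  have h1 : (N + dN) * X' + X' * (M + dM) = -W' := hN'.mul_sylv_add_sylv_mul hγ hM' W'
  have h2 := hN.sylv_mul_add_mul hγ hM X'
  have h3 : W' - W + dN * X' + X' * dM = -(N * X' + X' * M) + -W := by
    have : W' = -((N + dN) * X' + X' * (M + dM)) := by rw [h1, neg_neg]
    rw [this]; noncomm_ring
  rw [h3, hN.sylv_add hγ hM, sylv_neg, sylv_neg, h2, neg_neg, sub_eq_add_neg]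

/-- Second order expansion of the Sylvester integral, where `D₁` is the first order part of the
perturbation of `W` and `D₂` the second order part. -/
theorem Decays.norm_sylv_add_sub_le (hγ : 0 < γ) (hN : Decays κ γ N)
    (hM : Decays κ γ M) {dN dM : 𝔸} (hN' : Decays κ γ (N + dN)) (hM' : Decays κ γ (M + dM))
    (W D₁ D₂ : 𝔸) {w d q : ℝ} (hW : ‖W + D₁ + D₂‖ ≤ w) (hdN : ‖dN‖ ≤ d) (hdM : ‖dM‖ ≤ d)
    (hD₂ : ‖D₂‖ ≤ q) :
    ‖sylv (N + dN) (M + dM) (W + D₁ + D₂) - sylv N M W -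
        sylv N M (D₁ + dN * sylv N M W + sylv N M W * dM)‖ ≤
      κ ^ 2 / (2 * γ) * (q + 2 * d * (κ ^ 2 / (2 * γ) *
        (‖D₁‖ + q + 2 * d * (κ ^ 2 / (2 * γ) * w)))) := by
  set s := κ ^ 2 / (2 * γ) with hs
  have hs0 : 0 ≤ s := by positivity
  have hd0 : 0 ≤ d := (norm_nonneg _).trans hdN
  set W' := W + D₁ + D₂ with hW'
  have hsub := hN.sylv_sub_sylv hγ hM hN' hM' W W'
  set X := sylv N M W with hX
  set X' := sylv (N + dN) (M + dM) W' with hX'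
  have hX'n : ‖X'‖ ≤ s * w :=
    (hN'.norm_sylv_le hγ hM' W').trans (mul_le_mul_of_nonneg_left hW hs0)
  have hprod : ∀ Z : 𝔸, ‖dN * Z + Z * dM‖ ≤ 2 * d * ‖Z‖ := fun Z => by
    have h1 := (norm_mul_le dN Z).trans (mul_le_mul_of_nonneg_right hdN (norm_nonneg Z))
    have h2 := (norm_mul_le Z dM).trans (mul_le_mul_of_nonneg_left hdM (norm_nonneg Z))
    have h3 := norm_add_le (dN * Z) (Z * dM)
    linarith
  have hdiff : ‖X' - X‖ ≤ s * (‖D₁‖ + q + 2 * d * (s * w)) := by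
    rw [hsub]
    refine (hN.norm_sylv_le hγ hM _).trans (mul_le_mul_of_nonneg_left ?_ hs0)
    have e : W' - W + dN * X' + X' * dM = D₁ + D₂ + (dN * X' + X' * dM) := by
      rw [hW']; noncomm_ring
    rw [e]
    have h1 := norm_add_le (D₁ + D₂) (dN * X' + X' * dM)
    have h2 := norm_add_le D₁ D₂
    have h3 := (hprod X').trans (mul_le_mul_of_nonneg_left hX'n (by positivity))
    linarith
  have e : X' - X - sylv N M (D₁ + dN * X + X * dM) =
      sylv N M (D₂ + (dN * (X' - X) + (X' - X) * dM)) := by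
    rw [hsub, sub_eq_add_neg, ← sylv_neg, ← hN.sylv_add hγ hM, ← hsub]
    congr 1
    rw [hW']; noncomm_ring
  rw [e]
  refine (hN.norm_sylv_le hγ hM _).trans (mul_le_mul_of_nonneg_left ?_ hs0)
  have h1 := norm_add_le D₂ (dN * (X' - X) + (X' - X) * dM)
  have h3 := (hprod (X' - X)).trans (mul_le_mul_of_nonneg_left hdiff (by positivity))
  linarith

end Sylvester

end Algebra

/-! ### Hurwitz matrices -/

open scoped Polynomial in
/-- In a finite-dimensional algebra, `exp a = p(a)` for a polynomial `p` which also interpolates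
the exponential on the spectrum. The interpolation comes from applying the closedness of
`ℂ[x]` to `x = (a, spectrum of a)` in the product of the algebra with the functions on the
spectrum. -/
theorem exists_aeval_eq_exp {𝔸 : Type*} [NormedRing 𝔸] [NormedAlgebra ℂ 𝔸]
    [FiniteDimensional ℂ 𝔸] (a : 𝔸) (hfin : (spectrum ℂ a).Finite) :
    ∃ p : ℂ[X], Polynomial.aeval a p = exp a ∧ ∀ z ∈ spectrum ℂ a, p.eval z = Complex.exp z := by
  let _ : NormedAlgebra ℚ 𝔸 := NormedAlgebra.restrictScalars ℚ ℂ 𝔸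
  have : CompleteSpace 𝔸 := FiniteDimensional.complete ℂ 𝔸
  have := hfin.fintype
  let b : 𝔸 × (spectrum ℂ a → ℂ) := (a, fun z => z)
  have hb : exp b ∈ Algebra.adjoin ℂ {b} := by
    refine NormedSpace.exp_mem (R := ℂ) ?_ (Algebra.self_mem_adjoin_singleton ℂ b)
    exact Submodule.closed_of_finiteDimensional (Algebra.adjoin ℂ {b}).toSubmodule
  rw [Algebra.adjoin_singleton_eq_range_aeval] at hb
  obtain ⟨p, hp⟩ := hb
  have hp' : Polynomial.aeval b p = exp b := hp
  refine ⟨p, ?_, fun z hz => ?_⟩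
  · have h1 := congrArg Prod.fst hp'
    rw [Prod.fst_exp] at h1
    rw [← h1]
    exact Polynomial.aeval_algHom_apply (AlgHom.fst ℂ 𝔸 (spectrum ℂ a → ℂ)) b p
  · have h1 := congrArg (fun y => y.2 ⟨z, hz⟩) hp'
    simp only [Prod.snd_exp, Pi.coe_exp] at h1
    rw [Complex.exp_eq_exp_ℂ]
    refine Eq.trans ?_ h1
    have := Polynomial.aeval_algHom_apply
      ((Pi.evalAlgHom ℂ (fun _ : spectrum ℂ a => ℂ) ⟨z, hz⟩).comp
        (AlgHom.snd ℂ 𝔸 (spectrum ℂ a → ℂ))) b p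
    rw [← Polynomial.coe_aeval_eq_eval]
    exact this

/-- If the spectrum of `a` lies in the open left half plane, then `exp a` has spectral radius less
than one, so that its powers tend to zero. -/
theorem exists_norm_exp_nsmul_le {𝔸 : Type*} [NormedRing 𝔸] [NormedAlgebra ℂ 𝔸]
    [FiniteDimensional ℂ 𝔸] (a : 𝔸) (hfin : (spectrum ℂ a).Finite)
    (ha : ∀ z ∈ spectrum ℂ a, z.re < 0) : ∃ k : ℕ, 0 < k ∧ ‖exp (k • a)‖ ≤ 3 / 4 := by
  let _ : NormedAlgebra ℚ 𝔸 := NormedAlgebra.restrictScalars ℚ ℂ 𝔸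
  have : CompleteSpace 𝔸 := FiniteDimensional.complete ℂ 𝔸
  rcases subsingleton_or_nontrivial 𝔸 with hs | hs
  · refine ⟨1, one_pos, ?_⟩
    rw [Subsingleton.elim (exp (1 • a)) 0, norm_zero]
    norm_num
  obtain ⟨p, hp, hpz⟩ := exists_aeval_eq_exp a hfin
  have hrad : spectralRadius ℂ (exp a) < 1 := by
    have := spectrum.spectralRadius_lt_of_forall_lt (exp a) (r := 1) (fun z hz => by
      rw [← hp, spectrum.map_polynomial_aeval] at hz
      obtain ⟨w, hw, rfl⟩ := hz
      rw [← NNReal.coe_lt_coe, coe_nnnorm]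
      dsimp only
      rw [hpz w hw, Complex.norm_exp]
      simpa using ha w hw)
    simpa using this
  obtain ⟨c, hc, hc1⟩ := ENNReal.lt_iff_exists_nnreal_btwn.1 hrad
  have hc1' : (c : ℝ) < 1 := by exact_mod_cast hc1
  have h1 := (spectrum.pow_nnnorm_pow_one_div_tendsto_nhds_spectralRadius (exp a)).eventually
    (gt_mem_nhds hc)
  have h2 : ∀ᶠ k : ℕ in atTop, (c : ℝ) ^ k < 3 / 4 :=
    (tendsto_pow_atTop_nhds_zero_of_lt_one c.2 hc1').eventually (gt_mem_nhds (by norm_num))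
  obtain ⟨k, hk1, hk2, hk3⟩ := (h1.and (h2.and (eventually_gt_atTop 0))).exists
  refine ⟨k, hk3, ?_⟩
  have hk0 : (0 : ℝ) < k := by exact_mod_cast hk3
  have h3 : (‖exp a ^ k‖₊ : ENNReal) < (c : ENNReal) ^ k := by
    have := ENNReal.rpow_lt_rpow hk1 hk0
    rwa [← ENNReal.rpow_mul, one_div_mul_cancel hk0.ne', ENNReal.rpow_one,
      ENNReal.rpow_natCast] at this
  have h4 : ‖exp a ^ k‖ < (c : ℝ) ^ k := by exact_mod_cast h3
  rw [NormedSpace.exp_nsmul]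
  linarith

section Frobenius

open scoped Matrix.Norms.Frobenius

theorem properSpace_matrix (m n : Type*) [Fintype m] [Fintype n] :
    ProperSpace (Matrix m n ℝ) := FiniteDimensional.proper ℝ _

attribute [local instance] properSpace_matrix

theorem IsHurwitz.exists_norm_exp_le {n : ℕ} {M : Matrix (Fin n) (Fin n) ℝ} (hM : IsHurwitz M) :
    ∃ T : ℝ, 0 < T ∧ ‖exp (T • M)‖ ≤ 3 / 4 := by
  let φ : Matrix (Fin n) (Fin n) ℝ →+* Matrix (Fin n) (Fin n) ℂ := (algebraMap ℝ ℂ).mapMatrix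
  have hφ : Continuous φ := by
    refine continuous_pi fun i => continuous_pi fun j => ?_
    exact Complex.continuous_ofReal.comp (continuous_apply_apply i j)
  obtain ⟨k, hk, h⟩ := exists_norm_exp_nsmul_le (φ M) (Matrix.finite_spectrum _) hM
  have h' : ‖exp (k • φ M)‖ ≤ 3 / 4 := h
  refine ⟨k, by exact_mod_cast hk, ?_⟩
  have h1 : φ (exp ((k : ℝ) • M)) = exp (k • φ M) := by
    let _ : NormedAlgebra ℚ (Matrix (Fin n) (Fin n) ℝ) := NormedAlgebra.restrictScalars ℚ ℝ _
    rw [← map_nsmul, ← Nat.cast_smul_eq_nsmul ℝ]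
    exact NormedSpace.map_exp φ hφ _
  rw [← h1] at h'
  refine le_of_eq_of_le ?_ h'
  exact (Matrix.frobenius_norm_map_eq _ _ (fun a => by simp)).symm

theorem IsHurwitz.exists_decays {n : ℕ} {M : Matrix (Fin n) (Fin n) ℝ} (hM : IsHurwitz M) :
    ∃ κ γ : ℝ, 0 < κ ∧ 0 < γ ∧ Decays κ γ M := by
  obtain ⟨T, hT, h⟩ := hM.exists_norm_exp_le
  obtain ⟨κ, γ, hκ, hγ, h'⟩ :=
    exists_decays_of_norm_exp_le (𝔸 := Matrix (Fin n) (Fin n) ℝ) ‖M‖ T hT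
  exact ⟨κ, γ, hκ, hγ, h' M le_rfl h⟩

/-! ### The Frobenius norm -/

theorem frobenius_sq_norm {k l : ℕ} (N : Matrix (Fin k) (Fin l) ℝ) :
    ‖N‖ ^ 2 = ∑ i, ∑ j, N i j ^ 2 := by
  have h0 : 0 ≤ ∑ i, ∑ j, N i j ^ 2 := by positivity
  rw [Matrix.frobenius_norm_def]
  simp only [Real.norm_eq_abs, Real.rpow_two, sq_abs]
  rw [← Real.sqrt_eq_rpow, Real.sq_sqrt h0]

theorem norm_gain_mat {m p : ℕ} (K : Gain m p) : ‖K.mat‖ = ‖K‖ := by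
  have h : ‖K.mat‖ ^ 2 = ‖K‖ ^ 2 := by
    rw [frobenius_sq_norm, EuclideanSpace.norm_sq_eq, Fintype.sum_prod_type]
    simp [Gain.mat]
  exact (pow_left_inj₀ (norm_nonneg _) (norm_nonneg _) two_ne_zero).1 h

theorem two_mul_trace_transpose_mul_le {k l : ℕ} (X Y : Matrix (Fin k) (Fin l) ℝ) :
    2 * (X.transpose * Y).trace ≤ ‖X‖ ^ 2 / 2 + 2 * ‖Y‖ ^ 2 := by
  rw [frobenius_sq_norm, frobenius_sq_norm, Matrix.trace]
  simp only [Matrix.diag_apply, Matrix.mul_apply, Matrix.transpose_apply]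
  rw [Finset.sum_comm, Finset.mul_sum, Finset.sum_div, Finset.mul_sum, ← Finset.sum_add_distrib]
  refine Finset.sum_le_sum fun i _ => ?_
  rw [Finset.mul_sum, Finset.sum_div, Finset.mul_sum, ← Finset.sum_add_distrib]
  refine Finset.sum_le_sum fun j _ => ?_
  nlinarith [sq_nonneg (X i j - 2 * Y i j)]

theorem trace_transpose_mul_self {k l : ℕ} (X : Matrix (Fin k) (Fin l) ℝ) :
    (X.transpose * X).trace = ‖X‖ ^ 2 := by
  rw [frobenius_sq_norm, Matrix.trace]
  simp only [Matrix.diag_apply, Matrix.mul_apply, Matrix.transpose_apply]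
  rw [Finset.sum_comm]
  simp [sq]

theorem exists_pos_mul_dotProduct_le {k : ℕ} {Z : Matrix (Fin k) (Fin k) ℝ} (hZ : Z.PosDef) :
    ∃ c : ℝ, 0 < c ∧ ∀ v : Fin k → ℝ, c * (v ⬝ᵥ v) ≤ v ⬝ᵥ Z.mulVec v := by
  rcases isEmpty_or_nonempty (Fin k) with hk | hk
  · exact ⟨1, one_pos, fun v => by simp [dotProduct]⟩
  have hcont : Continuous fun v : EuclideanSpace ℝ (Fin k) => v.ofLp ⬝ᵥ Z.mulVec v.ofLp := by
    fun_prop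
  obtain ⟨w, hw, hmin⟩ := (isCompact_sphere (0 : EuclideanSpace ℝ (Fin k)) 1).exists_isMinOn
    (NormedSpace.sphere_nonempty.2 zero_le_one) hcont.continuousOn
  have hw0 : w.ofLp ≠ 0 := by
    intro h
    have : w = 0 := by ext i; exact congrFun h i
    rw [this] at hw
    simp at hw
  refine ⟨_, by simpa using hZ.dotProduct_mulVec_pos hw0, fun v => ?_⟩
  rcases eq_or_ne v 0 with rfl | hv
  · simp
  set u : EuclideanSpace ℝ (Fin k) := WithLp.toLp 2 v with hu
  have hu0 : ‖u‖ ≠ 0 := by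
    rw [norm_ne_zero_iff]; intro h; apply hv; ext i; exact congrArg (fun y => y i) h
  have h1 := hmin (show ‖u‖⁻¹ • u ∈ Metric.sphere (0 : EuclideanSpace ℝ (Fin k)) 1 by
    simp [norm_smul, hu0])
  have h2 : v ⬝ᵥ v = ‖u‖ ^ 2 := by
    rw [EuclideanSpace.norm_sq_eq]; simp [dotProduct, hu, sq]
  have h1 : w.ofLp ⬝ᵥ Z.mulVec w.ofLp ≤ ‖u‖⁻¹ * (‖u‖⁻¹ * (v ⬝ᵥ Z.mulVec v)) := by
    simpa [Matrix.mulVec_smul] using h1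
  rw [h2]
  have h3 := mul_le_mul_of_nonneg_right h1 (sq_nonneg ‖u‖)
  refine h3.trans (le_of_eq ?_)
  field_simp

/-! ### Second moments -/

section Moments

variable {n : ℕ} (D : Measure (EuclideanSpace ℝ (Fin n)))

/-- The linear form `Z ↦ E[xᵀ Z x]`, written through the second moment matrix of `D`. -/
def momentForm : Matrix (Fin n) (Fin n) ℝ →ₗ[ℝ] ℝ where
  toFun Z := ∑ i, ∑ j, Z i j * secondMoment D i j
  map_add' Y Z := by simp [add_mul, Finset.sum_add_distrib]
  map_smul' c Z := by simp [Finset.mul_sum, mul_assoc]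

/-- The linear form `Z ↦ xᵀ Z x`. -/
def quadForm (x : EuclideanSpace ℝ (Fin n)) : Matrix (Fin n) (Fin n) ℝ →ₗ[ℝ] ℝ where
  toFun Z := x.ofLp ⬝ᵥ Z.mulVec x.ofLp
  map_add' Y Z := by simp [Matrix.add_mulVec, dotProduct_add]
  map_smul' c Z := by simp [Matrix.smul_mulVec]

theorem quadForm_eq_sum (x : EuclideanSpace ℝ (Fin n)) (Z : Matrix (Fin n) (Fin n) ℝ) :
    quadForm x Z = ∑ i, ∑ j, Z i j * (x i * x j) := by
  simp only [quadForm, LinearMap.coe_mk, AddHom.coe_mk, dotProduct, Matrix.mulVec,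
    Finset.mul_sum]
  exact Finset.sum_congr rfl fun i _ => Finset.sum_congr rfl fun j _ => by ring

theorem quadForm_transpose_mul_mul {k : ℕ} (x : EuclideanSpace ℝ (Fin n))
    (N : Matrix (Fin k) (Fin n) ℝ) (Z : Matrix (Fin k) (Fin k) ℝ) :
    quadForm x (N.transpose * Z * N) = N.mulVec x.ofLp ⬝ᵥ Z.mulVec (N.mulVec x.ofLp) := by
  simp only [quadForm, LinearMap.coe_mk, AddHom.coe_mk]
  rw [Matrix.mul_assoc, ← Matrix.mulVec_mulVec, Matrix.dotProduct_mulVec, Matrix.vecMul_transpose,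
    Matrix.mulVec_mulVec]

theorem abs_quadForm_le (x : EuclideanSpace ℝ (Fin n)) (Z : Matrix (Fin n) (Fin n) ℝ) :
    |quadForm x Z| ≤ ‖Z‖ * ‖x‖ ^ 2 := by
  have h1 : quadForm x Z = inner ℝ x (WithLp.toLp 2 (Z.mulVec x.ofLp)) := by
    simp [quadForm, PiLp.inner_apply, dotProduct, mul_comm]
  have h2 : ‖WithLp.toLp 2 (Z.mulVec x.ofLp)‖ ≤ ‖Z‖ * ‖x‖ := by
    have := Matrix.frobenius_norm_mul Z (Matrix.replicateCol Unit x.ofLp)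
    rw [← Matrix.replicateCol_mulVec, Matrix.frobenius_norm_replicateCol,
      Matrix.frobenius_norm_replicateCol] at this
    exact this
  rw [h1]
  refine (abs_real_inner_le_norm _ _).trans ?_
  nlinarith [norm_nonneg x]

variable [IsProbabilityMeasure D] {P : ℝ} (hbound : ∀ᵐ x ∂D, ‖x‖ ≤ P)
include hbound

theorem integrable_coord_mul (i j : Fin n) : Integrable (fun x => x i * x j) D := by
  refine Integrable.of_bound (C := P * P) (by fun_prop) ?_
  filter_upwards [hbound] with x hx
  rw [norm_mul]
  exact mul_le_mul ((PiLp.norm_apply_le x i).trans hx) ((PiLp.norm_apply_le x j).trans hx)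
    (norm_nonneg _) ((norm_nonneg _).trans hx)

theorem integrable_quadForm (Z : Matrix (Fin n) (Fin n) ℝ) :
    Integrable (fun x => quadForm x Z) D := by
  simp only [quadForm_eq_sum]
  exact integrable_finsetSum _ fun i _ => integrable_finsetSum _ fun j _ =>
    (integrable_coord_mul D hbound i j).const_mul _

theorem integral_quadForm (Z : Matrix (Fin n) (Fin n) ℝ) :
    ∫ x, quadForm x Z ∂D = momentForm D Z := by
  simp only [quadForm_eq_sum]
  refine (integral_finsetSum _ fun i _ => integrable_finsetSum _ fun j _ =>
    (integrable_coord_mul D hbound i j).const_mul _).trans (Finset.sum_congr rfl fun i _ => ?_)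
  refine (integral_finsetSum _ fun j _ =>
    (integrable_coord_mul D hbound i j).const_mul _).trans (Finset.sum_congr rfl fun j _ => ?_)
  exact integral_const_mul _ _

/-- Positive definiteness of the second moment makes `E[(N x)ᵀ Z (N x)]` control the norm
of `N`. -/
theorem exists_pos_mul_sq_norm_le (hSigma : (secondMoment D).PosDef) {k : ℕ}
    {Z : Matrix (Fin k) (Fin k) ℝ} (hZ : Z.PosDef) : ∃ c : ℝ, 0 < c ∧
      ∀ N : Matrix (Fin k) (Fin n) ℝ, c * ‖N‖ ^ 2 ≤ momentForm D (N.transpose * Z * N) := by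
  obtain ⟨q, hq, hqv⟩ := exists_pos_mul_dotProduct_le hZ
  obtain ⟨s, hs, hsv⟩ := exists_pos_mul_dotProduct_le hSigma
  refine ⟨q * s, by positivity, fun N => ?_⟩
  have h1 : q * momentForm D (N.transpose * N) ≤ momentForm D (N.transpose * Z * N) := by
    rw [← integral_quadForm D hbound, ← integral_quadForm D hbound, ← integral_const_mul]
    refine integral_mono ((integrable_quadForm D hbound _).const_mul _)
      (integrable_quadForm D hbound _) fun x => ?_
    have e := quadForm_transpose_mul_mul x N 1
    rw [Matrix.mul_one, Matrix.one_mulVec] at e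
    simp only [e, quadForm_transpose_mul_mul]
    exact hqv _
  have h2 : s * ‖N‖ ^ 2 ≤ momentForm D (N.transpose * N) := by
    have e : momentForm D (N.transpose * N) =
        ∑ k, N k ⬝ᵥ (secondMoment D).mulVec (N k) := by
      simp only [momentForm, LinearMap.coe_mk, AddHom.coe_mk, Matrix.mul_apply,
        Matrix.transpose_apply, dotProduct, Matrix.mulVec, Finset.mul_sum, Finset.sum_mul]
      rw [Finset.sum_comm' (t' := Finset.univ) (s' := fun _ => Finset.univ) (by simp)]
      conv_lhs => enter [2, j]; rw [Finset.sum_comm]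
      rw [Finset.sum_comm]
      refine Finset.sum_congr rfl fun k _ => ?_
      rw [Finset.sum_comm]
      exact Finset.sum_congr rfl fun i _ => Finset.sum_congr rfl fun j _ => by ring
    rw [e, frobenius_sq_norm, Finset.mul_sum]
    refine Finset.sum_le_sum fun k _ => le_trans (le_of_eq ?_) (hsv (N k))
    simp [dotProduct, sq]
  calc q * s * ‖N‖ ^ 2 = q * (s * ‖N‖ ^ 2) := by ring
    _ ≤ _ := (mul_le_mul_of_nonneg_left h2 hq.le).trans h1

end Moments

/-! ### Matrix semigroups -/

section Semigroup

variable {n : ℕ} {M : Matrix (Fin n) (Fin n) ℝ} {κ γ : ℝ}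

/- The exponential in the definition of the state refers to the entrywise topology on matrices, the
one in the results on normed algebras to the topology of the Frobenius norm. The two are
definitionally equal, and the lemmas of this section restate those results for the former. -/

theorem continuous_matrix_exp_smul (M : Matrix (Fin n) (Fin n) ℝ) :
    Continuous fun t : ℝ => exp (t • M) := continuous_exp_smul M

theorem continuous_matrix_exp (n : ℕ) :
    Continuous (exp : Matrix (Fin n) (Fin n) ℝ → Matrix (Fin n) (Fin n) ℝ) :=
  continuous_exp_algebra

theorem Decays.norm_matrix_exp_le (hM : Decays κ γ M) {t : ℝ} (ht : 0 ≤ t) :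
    ‖exp (t • M)‖ ≤ κ * Real.exp (-(γ * t)) := hM t ht

theorem Decays.transpose (hM : Decays κ γ M) : Decays κ γ M.transpose := by
  intro t ht
  have h := hM.norm_matrix_exp_le ht
  have e : exp (t • M.transpose) = (exp (t • M)).transpose := by
    rw [← Matrix.exp_transpose, Matrix.transpose_smul]
  rw [← Matrix.frobenius_norm_transpose, ← e] at h
  exact h

theorem exp_mul_mul_exp_eq (M Y : Matrix (Fin n) (Fin n) ℝ) (t : ℝ) :
    exp (t • M.transpose) * Y * exp (t • M) = (exp (t • M)).transpose * Y * exp (t • M) := by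
  rw [← Matrix.exp_transpose, Matrix.transpose_smul]

theorem Decays.integrableOn_apply (hγ : 0 < γ) (hM : Decays κ γ M)
    (l : Matrix (Fin n) (Fin n) ℝ →ₗ[ℝ] ℝ) (Y : Matrix (Fin n) (Fin n) ℝ) :
    IntegrableOn (fun t : ℝ => l ((exp (t • M)).transpose * Y * exp (t • M))) (Ioi 0) := by
  have h := (LinearMap.toContinuousLinearMap l).integrable_comp
    (hM.transpose.integrableOn hγ hM Y)
  refine h.congr (ae_of_all _ fun t => ?_)
  exact congrArg l (exp_mul_mul_exp_eq M Y t)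

theorem Decays.apply_sylv (hγ : 0 < γ) (hM : Decays κ γ M)
    (l : Matrix (Fin n) (Fin n) ℝ →ₗ[ℝ] ℝ) (Y : Matrix (Fin n) (Fin n) ℝ) :
    l (sylv M.transpose M Y) =
      ∫ t in Ioi (0 : ℝ), l ((exp (t • M)).transpose * Y * exp (t • M)) := by
  have h := (LinearMap.toContinuousLinearMap l).integral_comp_comm
    (hM.transpose.integrableOn hγ hM Y)
  refine h.symm.trans (integral_congr_ae (ae_of_all _ fun t => ?_))
  exact congrArg l (exp_mul_mul_exp_eq M Y t)

theorem Decays.integrableOn_sq_norm_mul (hγ : 0 < γ) (hM : Decays κ γ M) {k : ℕ}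
    (N : Matrix (Fin k) (Fin n) ℝ) :
    IntegrableOn (fun t : ℝ => ‖N * exp (t • M)‖ ^ 2) (Ioi 0) := by
  refine (hM.integrableOn_apply hγ (Matrix.traceLinearMap (Fin n) ℝ ℝ)
    (N.transpose * N)).congr (ae_of_all _ fun t => ?_)
  dsimp only
  rw [Matrix.traceLinearMap_apply, ← trace_transpose_mul_self, Matrix.transpose_mul]
  simp only [Matrix.mul_assoc]

/-- The energy of `G exp (t M)` over the time scale `1 / (1 + ‖M‖)` of the generator is at least
a multiple of `‖G‖² / (1 + ‖M‖)`. -/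
theorem exists_sq_norm_le_mul_integral (n k : ℕ) : ∃ c : ℝ, 0 < c ∧
    ∀ (M : Matrix (Fin n) (Fin n) ℝ) (G : Matrix (Fin k) (Fin n) ℝ),
      IntegrableOn (fun t : ℝ => ‖G * exp (t • M)‖ ^ 2) (Ioi 0) →
      ‖G‖ ^ 2 ≤ c * (1 + ‖M‖) * ∫ t in Ioi (0 : ℝ), ‖G * exp (t • M)‖ ^ 2 := by
  obtain ⟨C, hC1, hC⟩ := exists_norm_exp_le (𝔸 := Matrix (Fin n) (Fin n) ℝ) 1
  refine ⟨C ^ 2, by positivity, fun M G hi => ?_⟩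
  have hM0 : 0 < 1 + ‖M‖ := by positivity
  set s : ℝ := (1 + ‖M‖)⁻¹ with hs
  have hs0 : 0 < s := by positivity
  have hcont : Continuous fun t : ℝ => ‖G * exp (t • M)‖ ^ 2 := by
    have := continuous_matrix_exp_smul M
    have h2 : Continuous fun t : ℝ => G * exp (t • M) := continuous_const.matrix_mul this
    exact (continuous_norm.comp h2).pow 2
  have h1 : ∫ t in (0 : ℝ)..s, ‖G‖ ^ 2 ≤ ∫ t in (0 : ℝ)..s, C ^ 2 * ‖G * exp (t • M)‖ ^ 2 := by
    apply intervalIntegral.integral_mono_on hs0.le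
    · exact continuous_const.intervalIntegrable _ _
    · exact (hcont.const_mul _).intervalIntegrable _ _
    · intro t ht
      have e1 : exp (t • M) * exp ((-t) • M) = 1 := by
        have := exp_add_smul t (-t) M
        rw [add_neg_cancel, zero_smul, NormedSpace.exp_zero] at this
        exact this.symm
      have e2 : ‖exp ((-t) • M)‖ ≤ C := by
        apply hC
        rw [norm_smul, norm_neg, Real.norm_of_nonneg ht.1]
        calc t * ‖M‖ ≤ s * (1 + ‖M‖) :=
              mul_le_mul ht.2 (by linarith) (norm_nonneg _) hs0.le
          _ = 1 := inv_mul_cancel₀ hM0.ne'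
      have e3 : ‖G‖ ≤ ‖G * exp (t • M)‖ * C := by
        calc ‖G‖ = ‖G * exp (t • M) * exp ((-t) • M)‖ := by
              rw [Matrix.mul_assoc, e1, Matrix.mul_one]
          _ ≤ _ := (Matrix.frobenius_norm_mul _ _).trans
            (mul_le_mul_of_nonneg_left e2 (norm_nonneg _))
      calc ‖G‖ ^ 2 ≤ (‖G * exp (t • M)‖ * C) ^ 2 := pow_le_pow_left₀ (norm_nonneg _) e3 2
        _ = _ := by ring
  have h2 : ∫ t in (0 : ℝ)..s, ‖G * exp (t • M)‖ ^ 2 ≤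
      ∫ t in Ioi (0 : ℝ), ‖G * exp (t • M)‖ ^ 2 := by
    rw [intervalIntegral.integral_of_le hs0.le]
    exact setIntegral_mono_set hi (ae_of_all _ fun _ => by positivity)
      Ioc_subset_Ioi_self.eventuallyLE
  rw [intervalIntegral.integral_const, intervalIntegral.integral_const_mul, sub_zero,
    smul_eq_mul] at h1
  have h3 := h1.trans (mul_le_mul_of_nonneg_left h2 (sq_nonneg C))
  have h4 := mul_le_mul_of_nonneg_left h3 hM0.le
  rw [hs, ← mul_assoc, mul_inv_cancel₀ hM0.ne', one_mul] at h4
  exact h4.trans (le_of_eq (by ring))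

end Semigroup

/-! ### Uniform stability on a sublevel set -/

namespace LQProblem

variable {n m p : ℕ} (S : LQProblem n m p)

/-- The weight `Cᵀ Q C + (K C)ᵀ R (K C)` of the state in the running cost under the gain `K`. -/
def stageWeight (K : Gain m p) : Matrix (Fin n) (Fin n) ℝ :=
  S.C.transpose * S.Q * S.C + (K.mat * S.C).transpose * S.R * (K.mat * S.C)

theorem runningCost_eq (K : Gain m p) (x : EuclideanSpace ℝ (Fin n)) (t : ℝ) :
    S.runningCost K x t = quadForm x ((exp (t • S.closedLoop K)).transpose * S.stageWeight K *
      exp (t • S.closedLoop K)) := by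
  rw [quadForm_transpose_mul_mul]
  change _ = quadForm (WithLp.toLp 2 (S.state K x t)) (S.stageWeight K)
  rw [stageWeight, map_add, quadForm_transpose_mul_mul, quadForm_transpose_mul_mul]
  simp only [runningCost, input, output, Matrix.mulVec_neg, neg_dotProduct_neg,
    Matrix.mulVec_mulVec]

theorem integral_runningCost {κ γ : ℝ} (hγ : 0 < γ) {K : Gain m p}
    (hK : Decays κ γ (S.closedLoop K)) (x : EuclideanSpace ℝ (Fin n)) :
    ∫ t in Ioi (0 : ℝ), S.runningCost K x t =
      quadForm x (sylv (S.closedLoop K).transpose (S.closedLoop K) (S.stageWeight K)) := by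
  rw [hK.apply_sylv hγ]
  simp only [runningCost_eq]

theorem cost_eq {κ γ : ℝ} (hγ : 0 < γ) {K : Gain m p} (hK : Decays κ γ (S.closedLoop K))
    (D : Measure (EuclideanSpace ℝ (Fin n))) [IsProbabilityMeasure D] {P : ℝ}
    (hbound : ∀ᵐ x ∂D, ‖x‖ ≤ P) :
    S.cost D K = momentForm D
      (sylv (S.closedLoop K).transpose (S.closedLoop K) (S.stageWeight K)) := by
  simp only [cost, S.integral_runningCost hγ hK]
  exact integral_quadForm D hbound _

theorem closedLoop_eq (K : Gain m p) : S.closedLoop K = S.A - S.B * (K.mat * S.C) := by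
  rw [closedLoop, Matrix.mul_assoc]

section Uniform

variable (D : Measure (EuclideanSpace ℝ (Fin n))) [IsProbabilityMeasure D] {P : ℝ}
  (hbound : ∀ᵐ x ∂D, ‖x‖ ≤ P)
include hbound

/-- A bound on the cost bounds the energy of the output and of the input. -/
theorem exists_integral_output_input_le (hQ : S.Q.PosDef) (hR : S.R.PosDef)
    (hSigma : (secondMoment D).PosDef) (a : ℝ) : ∃ J : ℝ, 0 ≤ J ∧ ∀ K ∈ S.sublevel D a,
      ∫ t in Ioi (0 : ℝ), ‖S.C * exp (t • S.closedLoop K)‖ ^ 2 ≤ J ∧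
      ∫ t in Ioi (0 : ℝ), ‖(K.mat * S.C) * exp (t • S.closedLoop K)‖ ^ 2 ≤ J := by
  obtain ⟨q, hq, hqN⟩ := exists_pos_mul_sq_norm_le D hbound hSigma hQ
  obtain ⟨r, hr, hrN⟩ := exists_pos_mul_sq_norm_le D hbound hSigma hR
  have hJ1 : a / q ≤ |a| / q + |a| / r := by
    have := div_le_div_of_nonneg_right (le_abs_self a) hq.le
    have : 0 ≤ |a| / r := by positivity
    linarith
  have hJ2 : a / r ≤ |a| / q + |a| / r := by
    have := div_le_div_of_nonneg_right (le_abs_self a) hr.le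
    have : 0 ≤ |a| / q := by positivity
    linarith
  refine ⟨|a| / q + |a| / r, by positivity, fun K hK => ?_⟩
  obtain ⟨κ, γ, hκ, hγ, hdec⟩ := hK.1.exists_decays
  have hle := hK.2
  rw [S.cost_eq hγ hdec D hbound, hdec.apply_sylv hγ] at hle
  set E : ℝ → Matrix (Fin n) (Fin n) ℝ := fun t => exp (t • S.closedLoop K) with hE
  have hsplit : ∀ t, q * ‖S.C * E t‖ ^ 2 + r * ‖(K.mat * S.C) * E t‖ ^ 2 ≤
      momentForm D ((E t).transpose * S.stageWeight K * E t) := by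
    intro t
    have h1 := hqN (S.C * E t)
    have h2 := hrN ((K.mat * S.C) * E t)
    have e : (E t).transpose * S.stageWeight K * E t =
        (S.C * E t).transpose * S.Q * (S.C * E t) +
        ((K.mat * S.C) * E t).transpose * S.R * ((K.mat * S.C) * E t) := by
      rw [Matrix.transpose_mul S.C, Matrix.transpose_mul (K.mat * S.C), stageWeight]
      simp only [Matrix.mul_add, Matrix.add_mul, Matrix.mul_assoc]
    rw [e, map_add]
    linarith
  have hi := hdec.integrableOn_apply hγ (momentForm D) (S.stageWeight K)
  have hC := hdec.integrableOn_sq_norm_mul hγ S.C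
  have hG := hdec.integrableOn_sq_norm_mul hγ (K.mat * S.C)
  constructor
  · refine le_trans ?_ hJ1
    rw [le_div_iff₀ hq, mul_comm, ← integral_const_mul]
    refine (integral_mono (hC.const_mul q) hi fun t => ?_).trans hle
    have : 0 ≤ r * ‖(K.mat * S.C) * E t‖ ^ 2 := by positivity
    exact le_trans (by dsimp only; linarith) (hsplit t)
  · refine le_trans ?_ hJ2
    rw [le_div_iff₀ hr, mul_comm, ← integral_const_mul]
    refine (integral_mono (hG.const_mul r) hi fun t => ?_).trans hle
    have : 0 ≤ q * ‖S.C * E t‖ ^ 2 := by positivity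
    exact le_trans (by dsimp only; linarith) (hsplit t)

/-- Only `K C` is bounded on a sublevel set: `K` itself is not when `C` lacks full row rank. -/
theorem exists_norm_mat_mul_le (hQ : S.Q.PosDef) (hR : S.R.PosDef)
    (hSigma : (secondMoment D).PosDef) (a : ℝ) : ∃ g : ℝ, 0 ≤ g ∧ ∀ K ∈ S.sublevel D a,
      ‖K.mat * S.C‖ ≤ g := by
  obtain ⟨J, hJ, h⟩ := S.exists_integral_output_input_le D hbound hQ hR hSigma a
  obtain ⟨c, hc, hcG⟩ := exists_sq_norm_le_mul_integral n m
  refine ⟨1 + c * J * (1 + ‖S.A‖ + ‖S.B‖), by positivity, fun K hK => ?_⟩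
  obtain ⟨κ, γ, hκ, hγ, hdec⟩ := hK.1.exists_decays
  have h1 := hcG (S.closedLoop K) (K.mat * S.C) (hdec.integrableOn_sq_norm_mul hγ _)
  have h2 : ‖S.closedLoop K‖ ≤ ‖S.A‖ + ‖S.B‖ * ‖K.mat * S.C‖ := by
    rw [closedLoop_eq]
    exact (norm_sub_le _ _).trans (add_le_add_right (Matrix.frobenius_norm_mul _ _) _)
  set G := K.mat * S.C with hG
  have h3 : ‖G‖ ^ 2 ≤ c * (1 + (‖S.A‖ + ‖S.B‖ * ‖G‖)) * J := by
    refine h1.trans (mul_le_mul ?_ (h K hK).2 (integral_nonneg fun _ => by positivity)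
      (by positivity))
    gcongr
  -- The right side of `h3` is affine in `‖G‖`: for `‖G‖ > 1` one divides by `‖G‖`.
  rcases le_or_gt ‖G‖ 1 with hle | hlt
  · have : 0 ≤ c * J * (1 + ‖S.A‖ + ‖S.B‖) := by positivity
    linarith
  · have h4 : ‖G‖ * ‖G‖ ≤ ‖G‖ * (c * J * (1 + ‖S.A‖ + ‖S.B‖)) := by
      have h5 : 0 ≤ c * J * (1 + ‖S.A‖) * (‖G‖ - 1) := by
        have : 0 ≤ ‖G‖ - 1 := by linarith
        positivity
      nlinarith
    have := le_of_mul_le_mul_left h4 (by linarith)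
    linarith

/-- The energy of the state is bounded by that of the output and the input, because any element
`K₀` of the sublevel set provides the observer gain `B K₀`: the Lyapunov function of
`A - B K₀ C` is used along the trajectories of `A - B K C`. -/
theorem exists_integral_sq_norm_exp_le (hQ : S.Q.PosDef) (hR : S.R.PosDef)
    (hSigma : (secondMoment D).PosDef) (a : ℝ) : ∃ J : ℝ, 0 ≤ J ∧ ∀ K ∈ S.sublevel D a,
      ∫ t in Ioi (0 : ℝ), ‖exp (t • S.closedLoop K)‖ ^ 2 ≤ J := by
  rcases (S.sublevel D a).eq_empty_or_nonempty with hemp | ⟨K₀, hK₀⟩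
  · exact ⟨0, le_rfl, fun K hK => by simp [hemp] at hK⟩
  obtain ⟨J, hJ, h⟩ := S.exists_integral_output_input_le D hbound hQ hR hSigma a
  obtain ⟨κ₀, γ₀, -, hγ₀, hdec₀⟩ := hK₀.1.exists_decays
  set M₀ := S.closedLoop K₀ with hM₀
  obtain ⟨P₀, hP₀⟩ : ∃ P₀, M₀.transpose * P₀ + P₀ * M₀ = -1 :=
    ⟨_, hdec₀.transpose.mul_sylv_add_sylv_mul hγ₀ hdec₀ 1⟩
  set L := S.B * K₀.mat with hL
  refine ⟨2 * |P₀.trace| + 8 * ‖P₀‖ ^ 2 * ((‖L‖ ^ 2 + ‖S.B‖ ^ 2) * J), by positivity,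
    fun K hK => ?_⟩
  obtain ⟨κ, γ, hκ, hγ, hdec⟩ := hK.1.exists_decays
  set M := S.closedLoop K with hM
  set G := K.mat * S.C with hG
  set E : ℝ → Matrix (Fin n) (Fin n) ℝ := fun t => exp (t • M) with hE
  set Δ := M - M₀ with hΔ
  have hΔE : ∀ t, ‖Δ * E t‖ ^ 2 ≤
      2 * ‖L‖ ^ 2 * ‖S.C * E t‖ ^ 2 + 2 * ‖S.B‖ ^ 2 * ‖G * E t‖ ^ 2 := by
    intro t
    have e : Δ * E t = L * (S.C * E t) - S.B * (G * E t) := by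
      have : Δ = L * S.C - S.B * G := by
        rw [hΔ, hM, hM₀, closedLoop_eq, closedLoop, hL]; abel
      rw [this, Matrix.sub_mul, Matrix.mul_assoc L, Matrix.mul_assoc S.B G]
    have h1 : ‖Δ * E t‖ ≤ ‖L‖ * ‖S.C * E t‖ + ‖S.B‖ * ‖G * E t‖ := by
      rw [e]
      exact (norm_sub_le _ _).trans
        (add_le_add (Matrix.frobenius_norm_mul _ _) (Matrix.frobenius_norm_mul _ _))
    refine (pow_le_pow_left₀ (norm_nonneg _) h1 2).trans ?_
    nlinarith [sq_nonneg (‖L‖ * ‖S.C * E t‖ - ‖S.B‖ * ‖G * E t‖)]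
  -- The derivative of `tr (Eᵀ P₀ E)` is `-‖E‖²` up to cross terms in `Δ E`; Young's inequality
  -- absorbs these into half of `‖E‖²`.
  have hpt : ∀ t, (Matrix.traceLinearMap (Fin n) ℝ ℝ)
      ((E t).transpose * (M.transpose * P₀ + P₀ * M) * E t) ≤
      -(1 / 2) * ‖E t‖ ^ 2 + (4 * ‖P₀‖ ^ 2 * ‖L‖ ^ 2 * ‖S.C * E t‖ ^ 2 +
        4 * ‖P₀‖ ^ 2 * ‖S.B‖ ^ 2 * ‖G * E t‖ ^ 2) := by
    intro t
    have e1 : M.transpose * P₀ + P₀ * M = -1 + Δ.transpose * P₀ + P₀ * Δ := by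
      rw [← hP₀, hΔ, Matrix.transpose_sub, Matrix.sub_mul, Matrix.mul_sub]; abel
    have e2 : (E t).transpose * (M.transpose * P₀ + P₀ * M) * E t =
        -((E t).transpose * E t) + (P₀.transpose * (Δ * E t)).transpose * E t +
          (E t).transpose * (P₀ * (Δ * E t)) := by
      rw [e1, Matrix.transpose_mul P₀.transpose, Matrix.transpose_transpose,
        Matrix.transpose_mul Δ]
      simp only [Matrix.mul_add, Matrix.add_mul, Matrix.mul_assoc, Matrix.mul_neg,
        Matrix.neg_mul, Matrix.one_mul]
    have e3 : ((P₀.transpose * (Δ * E t)).transpose * E t).trace =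
        ((E t).transpose * (P₀.transpose * (Δ * E t))).trace := by
      rw [← Matrix.trace_transpose, Matrix.transpose_mul, Matrix.transpose_transpose]
    rw [e2, map_add, map_add, map_neg, Matrix.traceLinearMap_apply, Matrix.traceLinearMap_apply,
      Matrix.traceLinearMap_apply, trace_transpose_mul_self, e3]
    have h1 := two_mul_trace_transpose_mul_le (E t) (P₀.transpose * (Δ * E t))
    have h2 := two_mul_trace_transpose_mul_le (E t) (P₀ * (Δ * E t))
    have h3 := pow_le_pow_left₀ (norm_nonneg _)
      (Matrix.frobenius_norm_mul P₀.transpose (Δ * E t)) 2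
    have h4 := pow_le_pow_left₀ (norm_nonneg _) (Matrix.frobenius_norm_mul P₀ (Δ * E t)) 2
    rw [Matrix.frobenius_norm_transpose] at h3
    rw [mul_pow] at h3 h4
    have h5 := mul_le_mul_of_nonneg_left (hΔE t) (sq_nonneg ‖P₀‖)
    linarith
  have hid : (Matrix.traceLinearMap (Fin n) ℝ ℝ) (sylv M.transpose M (M.transpose * P₀ + P₀ * M))
      = -P₀.trace := by
    have : sylv M.transpose M (M.transpose * P₀ + P₀ * M) = -P₀ :=
      hdec.transpose.sylv_mul_add_mul hγ hdec P₀
    rw [this, map_neg, Matrix.traceLinearMap_apply]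
  rw [hdec.apply_sylv hγ] at hid
  have hiE : IntegrableOn (fun t : ℝ => ‖E t‖ ^ 2) (Ioi 0) := by
    simpa using hdec.integrableOn_sq_norm_mul hγ (1 : Matrix (Fin n) (Fin n) ℝ)
  have hiC := hdec.integrableOn_sq_norm_mul hγ S.C
  have hiG := hdec.integrableOn_sq_norm_mul hγ G
  have hmono := integral_mono (hdec.integrableOn_apply hγ (Matrix.traceLinearMap (Fin n) ℝ ℝ)
    (M.transpose * P₀ + P₀ * M)) ((hiE.const_mul (-(1 / 2))).add
      ((hiC.const_mul (4 * ‖P₀‖ ^ 2 * ‖L‖ ^ 2)).add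
        (hiG.const_mul (4 * ‖P₀‖ ^ 2 * ‖S.B‖ ^ 2)))) hpt
  rw [hid, integral_add' (hiE.const_mul _) ((hiC.const_mul _).add (hiG.const_mul _)),
    integral_add' (hiC.const_mul _) (hiG.const_mul _), integral_const_mul, integral_const_mul,
    integral_const_mul] at hmono
  have hb1 := mul_le_mul_of_nonneg_left (h K hK).1
    (show 0 ≤ 4 * ‖P₀‖ ^ 2 * ‖L‖ ^ 2 by positivity)
  have hb2 := mul_le_mul_of_nonneg_left (h K hK).2
    (show 0 ≤ 4 * ‖P₀‖ ^ 2 * ‖S.B‖ ^ 2 by positivity)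
  have hb3 := le_abs_self P₀.trace
  linarith

/-- On a sublevel set, and near it, the closed loops decay at a common exponential rate. -/
theorem exists_uniform_decays (hQ : S.Q.PosDef) (hR : S.R.PosDef)
    (hSigma : (secondMoment D).PosDef) (a : ℝ) : ∃ η κ γ : ℝ, 0 < η ∧ 0 < κ ∧ 0 < γ ∧
      ∀ K ∈ S.sublevel D a, ∀ Δ : Matrix (Fin n) (Fin n) ℝ, ‖Δ‖ ≤ η →
        Decays κ γ (S.closedLoop K + Δ) := by
  obtain ⟨g, hg, hgK⟩ := S.exists_norm_mat_mul_le D hbound hQ hR hSigma a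
  obtain ⟨J, hJ, hJK⟩ := S.exists_integral_sq_norm_exp_le D hbound hQ hR hSigma a
  obtain ⟨η, κ, γ, hη, hκ, hγ, h⟩ := exists_decays_add (𝔸 := Matrix (Fin n) (Fin n) ℝ)
    (‖S.A‖ + ‖S.B‖ * g) J hJ
  refine ⟨η, κ, γ, hη, hκ, hγ, fun K hK => h _ ?_ ?_ (hJK K hK)⟩
  · rw [closedLoop_eq]
    refine (norm_sub_le _ _).trans (add_le_add_right ((Matrix.frobenius_norm_mul _ _).trans ?_) _)
    exact mul_le_mul_of_nonneg_left (hgK K hK) (norm_nonneg _)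
  · obtain ⟨κ', γ', -, hγ', hdec⟩ := hK.1.exists_decays
    have := hdec.integrableOn_sq_norm_mul hγ' (1 : Matrix (Fin n) (Fin n) ℝ)
    simp only [Matrix.one_mul] at this
    exact this

end Uniform

end LQProblem

/-! ### Expansion of the cost and truncation error -/

theorem Gain.mat_add {m p : ℕ} (K H : Gain m p) : (K + H).mat = K.mat + H.mat := by
  ext i j; simp [Gain.mat]

theorem Gain.mat_smul {m p : ℕ} (c : ℝ) (K : Gain m p) : (c • K).mat = c • K.mat := by
  ext i j; simp [Gain.mat]

theorem norm_transpose_mul_mul_le {k l : ℕ} (X Y : Matrix (Fin k) (Fin l) ℝ)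
    (Z : Matrix (Fin k) (Fin k) ℝ) : ‖X.transpose * Z * Y‖ ≤ ‖Z‖ * (‖X‖ * ‖Y‖) := by
  refine (Matrix.frobenius_norm_mul _ _).trans ((mul_le_mul_of_nonneg_right
    (Matrix.frobenius_norm_mul _ _) (norm_nonneg _)).trans (le_of_eq ?_))
  rw [Matrix.frobenius_norm_transpose]; ring

theorem exists_abs_momentForm_le {n : ℕ} (D : Measure (EuclideanSpace ℝ (Fin n))) :
    ∃ c : ℝ, 0 ≤ c ∧ ∀ Z : Matrix (Fin n) (Fin n) ℝ, |momentForm D Z| ≤ c * ‖Z‖ :=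
  ⟨_, norm_nonneg _, (LinearMap.toContinuousLinearMap (momentForm D)).le_opNorm⟩

/-- A function with a uniformly quadratic first-order remainder has the linear part as its
gradient. -/
theorem hasGradientAt_of_abs_sub_le {F : Type*} [NormedAddCommGroup F] [InnerProductSpace ℝ F]
    [CompleteSpace F] {f : F → ℝ} {x g : F} {ρ L : ℝ} (hρ : 0 < ρ)
    (h : ∀ v, ‖v‖ ≤ ρ → |f (x + v) - f x - inner ℝ g v| ≤ L * ‖v‖ ^ 2) :
    HasGradientAt f g x := by
  rw [hasGradientAt_iff_hasFDerivAt, hasFDerivAt_iff_isLittleO_nhds_zero]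
  have h1 : (fun v : F => f (x + v) - f x - (InnerProductSpace.toDual ℝ F g) v) =O[𝓝 0]
      fun v => ‖v‖ ^ 2 := by
    refine Asymptotics.IsBigO.of_bound L ?_
    filter_upwards [Metric.closedBall_mem_nhds (0 : F) hρ] with v hv
    simpa using h v (by simpa using hv)
  refine h1.trans_isLittleO ?_
  simpa using (Asymptotics.isLittleO_norm_pow_id (E' := F) one_lt_two)

namespace LQProblem

variable {n m p : ℕ} (S : LQProblem n m p)

/-- The change of the closed-loop matrix under a change of the gain. -/
def closedLoopDiff (H : Gain m p) : Matrix (Fin n) (Fin n) ℝ := -(S.B * (H.mat * S.C))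

/-- The first order change of the state weight under a change `H` of the gain `K`. -/
def stageWeightDiff (K H : Gain m p) : Matrix (Fin n) (Fin n) ℝ :=
  (K.mat * S.C).transpose * S.R * (H.mat * S.C) + (H.mat * S.C).transpose * S.R * (K.mat * S.C)

theorem closedLoop_add (K H : Gain m p) :
    S.closedLoop (K + H) = S.closedLoop K + S.closedLoopDiff H := by
  rw [closedLoop_eq, closedLoop_eq, closedLoopDiff, Gain.mat_add, Matrix.add_mul, Matrix.mul_add]
  abel

theorem stageWeight_add (K H : Gain m p) : S.stageWeight (K + H) = S.stageWeight K +
    S.stageWeightDiff K H + (H.mat * S.C).transpose * S.R * (H.mat * S.C) := by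
  rw [stageWeight, stageWeight, stageWeightDiff, Gain.mat_add]
  simp only [Matrix.add_mul, Matrix.mul_add, Matrix.transpose_add]
  abel

theorem norm_mat_mul_le (H : Gain m p) : ‖H.mat * S.C‖ ≤ ‖H‖ * ‖S.C‖ := by
  rw [← norm_gain_mat]; exact Matrix.frobenius_norm_mul _ _

theorem norm_closedLoopDiff_le (H : Gain m p) :
    ‖S.closedLoopDiff H‖ ≤ ‖S.B‖ * ‖S.C‖ * ‖H‖ := by
  rw [closedLoopDiff, norm_neg]
  refine (Matrix.frobenius_norm_mul _ _).trans ?_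
  have := mul_le_mul_of_nonneg_left (S.norm_mat_mul_le H) (norm_nonneg S.B)
  linarith

theorem norm_stageWeight_le (K : Gain m p) {g : ℝ} (hg : ‖K.mat * S.C‖ ≤ g) :
    ‖S.stageWeight K‖ ≤ ‖S.Q‖ * ‖S.C‖ ^ 2 + ‖S.R‖ * g ^ 2 := by
  rw [stageWeight]
  refine (norm_add_le _ _).trans (add_le_add ?_ ?_)
  · rw [sq]; exact norm_transpose_mul_mul_le _ _ _
  · refine (norm_transpose_mul_mul_le _ _ _).trans ?_
    rw [sq]
    have := (norm_nonneg _).trans hg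
    gcongr

theorem norm_stageWeightDiff_le (K H : Gain m p) {g : ℝ} (hg : ‖K.mat * S.C‖ ≤ g) :
    ‖S.stageWeightDiff K H‖ ≤ 2 * ‖S.R‖ * g * ‖S.C‖ * ‖H‖ := by
  have h1 : ‖K.mat * S.C‖ * ‖H.mat * S.C‖ ≤ g * (‖H‖ * ‖S.C‖) :=
    mul_le_mul hg (S.norm_mat_mul_le H) (norm_nonneg _) ((norm_nonneg _).trans hg)
  have h2 := mul_le_mul_of_nonneg_left h1 (norm_nonneg S.R)
  have h3 := norm_transpose_mul_mul_le (K.mat * S.C) (H.mat * S.C) S.R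
  have h4 := norm_transpose_mul_mul_le (H.mat * S.C) (K.mat * S.C) S.R
  rw [mul_comm ‖H.mat * S.C‖] at h4
  have h5 := norm_add_le ((K.mat * S.C).transpose * S.R * (H.mat * S.C))
    ((H.mat * S.C).transpose * S.R * (K.mat * S.C))
  rw [stageWeightDiff]
  linarith

/-- The truncated cost is a quadratic form in the initial state, whose matrix approaches the
Lyapunov integral exponentially fast. -/
theorem exists_simulatedCost_eq {κ γ : ℝ} (hγ : 0 < γ) {K : Gain m p}
    (hK : Decays κ γ (S.closedLoop K)) {τ : ℝ} (hτ : 0 ≤ τ) :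
    ∃ Z : Matrix (Fin n) (Fin n) ℝ, (∀ x, S.simulatedCost τ K x = quadForm x Z) ∧
      ‖Z - sylv (S.closedLoop K).transpose (S.closedLoop K) (S.stageWeight K)‖ ≤
        κ ^ 2 / (2 * γ) * ‖S.stageWeight K‖ * Real.exp (-(2 * γ) * τ) := by
  refine ⟨_, fun x => ?_,
    hK.transpose.norm_intervalIntegral_sub_sylv_le hγ hK (S.stageWeight K) hτ⟩
  have h := (LinearMap.toContinuousLinearMap (quadForm x)).intervalIntegral_comp_comm
    ((continuous_exp_mul_mul_exp (S.closedLoop K).transpose (S.closedLoop K)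
      (S.stageWeight K)).intervalIntegrable (μ := volume) 0 τ)
  refine Eq.trans ?_ h
  refine intervalIntegral.integral_congr fun t _ => ?_
  refine (S.runningCost_eq K x t).trans ?_
  exact (congrArg (quadForm x) (exp_mul_mul_exp_eq (S.closedLoop K) (S.stageWeight K) t)).symm

variable (D : Measure (EuclideanSpace ℝ (Fin n))) [IsProbabilityMeasure D] {P : ℝ}
  (hbound : ∀ᵐ x ∂D, ‖x‖ ≤ P)
include hbound

/-- The cost has a gradient on the sublevel set, with a quadratic remainder that is uniform over
the sublevel set. -/
theorem exists_cost_expansion (hQ : S.Q.PosDef) (hR : S.R.PosDef)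
    (hSigma : (secondMoment D).PosDef) (a : ℝ) : ∃ ρ L : ℝ, 0 < ρ ∧ 0 ≤ L ∧
      ∀ K ∈ S.sublevel D a, ∃ g : Gain m p, ∀ H : Gain m p, ‖H‖ ≤ ρ →
        |S.cost D (K + H) - S.cost D K - inner ℝ g H| ≤ L * ‖H‖ ^ 2 := by
  obtain ⟨η, κ, γ, hη, hκ, hγ, hdec⟩ := S.exists_uniform_decays D hbound hQ hR hSigma a
  obtain ⟨g, hg, hgK⟩ := S.exists_norm_mat_mul_le D hbound hQ hR hSigma a
  obtain ⟨c, hc, hcD⟩ := exists_abs_momentForm_le D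
  set b := ‖S.B‖ * ‖S.C‖ with hb
  have hb0 : 0 ≤ b := by positivity
  set s := κ ^ 2 / (2 * γ) with hs
  have hs0 : 0 ≤ s := by positivity
  set d₁ := 2 * ‖S.R‖ * g * ‖S.C‖ with hd₁
  set q₁ := ‖S.R‖ * ‖S.C‖ ^ 2 with hq₁
  set w := ‖S.Q‖ * ‖S.C‖ ^ 2 + ‖S.R‖ * (g + ‖S.C‖) ^ 2 with hw
  refine ⟨min 1 (η / (1 + b)), c * (s * (q₁ + 2 * b * (s * (d₁ + q₁ + 2 * b * (s * w))))),
    by positivity, by positivity, fun K hK => ?_⟩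
  have hK0 : Decays κ γ (S.closedLoop K) := by
    simpa using hdec K hK 0 (by simpa using hη.le)
  set M := S.closedLoop K with hM
  set X := sylv M.transpose M (S.stageWeight K) with hX
  -- The first order change of the data of the Lyapunov equation, and below the derivative of the
  -- cost in the direction `H`.
  let Λ : Gain m p →ₗ[ℝ] Matrix (Fin n) (Fin n) ℝ :=
    { toFun := fun H => S.stageWeightDiff K H + (S.closedLoopDiff H).transpose * X +
        X * S.closedLoopDiff H
      map_add' := fun H₁ H₂ => by
        simp only [stageWeightDiff, closedLoopDiff, Gain.mat_add, Matrix.add_mul, Matrix.mul_add,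
          Matrix.transpose_add, neg_add, Matrix.neg_mul, Matrix.mul_neg, Matrix.transpose_neg]
        abel
      map_smul' := fun c H => by
        simp only [stageWeightDiff, closedLoopDiff, Gain.mat_smul, Matrix.smul_mul,
          Matrix.mul_smul, Matrix.transpose_smul, Matrix.neg_mul, Matrix.mul_neg,
          Matrix.transpose_neg, smul_add, smul_neg, RingHom.id_apply] }
  let l : Gain m p →ₗ[ℝ] ℝ :=
    { toFun := fun H => momentForm D (sylv M.transpose M (Λ H))
      map_add' := fun H₁ H₂ => by
        have := hK0.transpose.sylv_add hγ hK0 (Λ H₁) (Λ H₂)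
        rw [map_add Λ, ← map_add (momentForm D)]
        exact congrArg _ this
      map_smul' := fun c H => by
        have := sylv_smul c M.transpose M (Λ H)
        rw [map_smul Λ, RingHom.id_apply, ← map_smul (momentForm D)]
        exact congrArg _ this }
  refine ⟨(InnerProductSpace.toDual ℝ (Gain m p)).symm (LinearMap.toContinuousLinearMap l),
    fun H hH => ?_⟩
  have hH1 : ‖H‖ ≤ 1 := hH.trans (min_le_left _ _)
  have hΔ := S.norm_closedLoopDiff_le H
  have hΔη : ‖S.closedLoopDiff H‖ ≤ η := by
    have h1 : ‖H‖ * (1 + b) ≤ η := (le_div_iff₀ (by positivity)).1 (hH.trans (min_le_right _ _))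
    nlinarith [norm_nonneg H]
  have hKH : Decays κ γ (M + S.closedLoopDiff H) := hdec K hK _ hΔη
  have hcl := S.closedLoop_add K H
  have hKH' : Decays κ γ (S.closedLoop (K + H)) := by rw [hcl]; exact hKH
  have hKHt : Decays κ γ (M.transpose + (S.closedLoopDiff H).transpose) := by
    have := hKH.transpose
    rw [Matrix.transpose_add] at this
    exact this
  set D₂ := (H.mat * S.C).transpose * S.R * (H.mat * S.C) with hD₂
  have hD₂n : ‖D₂‖ ≤ q₁ * ‖H‖ ^ 2 := by
    refine (norm_transpose_mul_mul_le _ _ _).trans ?_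
    have h1 := S.norm_mat_mul_le H
    calc ‖S.R‖ * (‖H.mat * S.C‖ * ‖H.mat * S.C‖) ≤ ‖S.R‖ * ((‖H‖ * ‖S.C‖) * (‖H‖ * ‖S.C‖)) := by
          gcongr
      _ = _ := by rw [hq₁]; ring
  have hWn : ‖S.stageWeight K + S.stageWeightDiff K H + D₂‖ ≤ w := by
    rw [← S.stageWeight_add]
    refine S.norm_stageWeight_le _ ?_
    rw [Gain.mat_add, Matrix.add_mul]
    refine (norm_add_le _ _).trans (add_le_add (hgK K hK) ((S.norm_mat_mul_le H).trans ?_))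
    nlinarith [norm_nonneg S.C]
  have key := hK0.transpose.norm_sylv_add_sub_le hγ hK0 hKHt hKH (S.stageWeight K)
    (S.stageWeightDiff K H) D₂ hWn (d := b * ‖H‖)
    ((Matrix.frobenius_norm_transpose _).trans_le hΔ) hΔ hD₂n
  have e : S.cost D (K + H) - S.cost D K -
      inner ℝ ((InnerProductSpace.toDual ℝ (Gain m p)).symm
        (LinearMap.toContinuousLinearMap l)) H =
      momentForm D (sylv (M.transpose + (S.closedLoopDiff H).transpose) (M + S.closedLoopDiff H)
        (S.stageWeight K + S.stageWeightDiff K H + D₂) - X - sylv M.transpose M (Λ H)) := by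
    rw [InnerProductSpace.toDual_symm_apply, S.cost_eq hγ hKH' D hbound,
      S.cost_eq hγ hK0 D hbound, hcl, S.stageWeight_add, map_sub, map_sub, Matrix.transpose_add]
    rfl
  rw [e]
  refine (hcD _).trans ?_
  rw [mul_assoc c]
  refine mul_le_mul_of_nonneg_left (key.trans ?_) hc
  rw [mul_assoc s]
  refine mul_le_mul_of_nonneg_left ?_ hs0
  have h1 := S.norm_stageWeightDiff_le K H (hgK K hK)
  have h2 : ‖S.stageWeightDiff K H‖ + q₁ * ‖H‖ ^ 2 + 2 * (b * ‖H‖) * (s * w) ≤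
      (d₁ + q₁ + 2 * b * (s * w)) * ‖H‖ := by
    have h3 : q₁ * ‖H‖ ^ 2 ≤ q₁ * ‖H‖ := by
      refine mul_le_mul_of_nonneg_left ?_ (by positivity)
      nlinarith [norm_nonneg H]
    linarith
  have h3 := mul_le_mul_of_nonneg_left h2 (show 0 ≤ 2 * (b * ‖H‖) * s by positivity)
  linarith

/-- Bounds for the truncated cost that are uniform over a neighbourhood of the sublevel set. -/
theorem exists_simulatedCost_bounds (hQ : S.Q.PosDef) (hR : S.R.PosDef)
    (hSigma : (secondMoment D).PosDef) (a : ℝ) : ∃ ρ L β : ℝ, 0 < ρ ∧ 0 ≤ L ∧ 0 < β ∧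
      ∀ K ∈ S.sublevel D a, ∀ H : Gain m p, ‖H‖ ≤ ρ → ∀ τ : ℝ, 0 ≤ τ →
        (∀ x, |S.simulatedCost τ (K + H) x| ≤ L * ‖x‖ ^ 2) ∧
        |∫ x, S.simulatedCost τ (K + H) x ∂D - S.cost D (K + H)| ≤ L * Real.exp (-(β * τ)) := by
  obtain ⟨η, κ, γ, hη, hκ, hγ, hdec⟩ := S.exists_uniform_decays D hbound hQ hR hSigma a
  obtain ⟨g, hg, hgK⟩ := S.exists_norm_mat_mul_le D hbound hQ hR hSigma a
  obtain ⟨c, hc, hcD⟩ := exists_abs_momentForm_le D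
  set b := ‖S.B‖ * ‖S.C‖ with hb
  have hb0 : 0 ≤ b := by positivity
  set s := κ ^ 2 / (2 * γ) with hs
  have hs0 : 0 ≤ s := by positivity
  set w := ‖S.Q‖ * ‖S.C‖ ^ 2 + ‖S.R‖ * (g + ‖S.C‖) ^ 2 with hw
  refine ⟨min 1 (η / (1 + b)), (2 + c) * (s * w), 2 * γ, by positivity, by positivity,
    by positivity, fun K hK H hH τ hτ => ?_⟩
  have hH1 : ‖H‖ ≤ 1 := hH.trans (min_le_left _ _)
  have hΔη : ‖S.closedLoopDiff H‖ ≤ η := by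
    have h1 : ‖H‖ * (1 + b) ≤ η := (le_div_iff₀ (by positivity)).1 (hH.trans (min_le_right _ _))
    nlinarith [norm_nonneg H, S.norm_closedLoopDiff_le H]
  have hKH : Decays κ γ (S.closedLoop (K + H)) := by
    rw [S.closedLoop_add]; exact hdec K hK _ hΔη
  have hWn : ‖S.stageWeight (K + H)‖ ≤ w := by
    refine S.norm_stageWeight_le _ ?_
    rw [Gain.mat_add, Matrix.add_mul]
    refine (norm_add_le _ _).trans (add_le_add (hgK K hK) ((S.norm_mat_mul_le H).trans ?_))
    nlinarith [norm_nonneg S.C]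
  obtain ⟨Z, hZ, hZn⟩ := S.exists_simulatedCost_eq hγ hKH hτ
  set X := sylv (S.closedLoop (K + H)).transpose (S.closedLoop (K + H)) (S.stageWeight (K + H))
    with hX
  have hXn : ‖X‖ ≤ s * w := (hKH.transpose.norm_sylv_le hγ hKH _).trans
    (mul_le_mul_of_nonneg_left hWn hs0)
  have hsw : s * ‖S.stageWeight (K + H)‖ ≤ s * w := mul_le_mul_of_nonneg_left hWn hs0
  have hZn' : ‖Z - X‖ ≤ s * w * Real.exp (-(2 * γ * τ)) := by
    rw [← neg_mul]
    exact hZn.trans (mul_le_mul_of_nonneg_right hsw (Real.exp_pos _).le)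
  have he : Real.exp (-(2 * γ * τ)) ≤ 1 := Real.exp_le_one_iff.2 (by
    have : 0 ≤ 2 * γ * τ := by positivity
    linarith)
  have hsw0 : 0 ≤ s * w := by positivity
  constructor
  · intro x
    rw [hZ]
    refine (abs_quadForm_le x Z).trans (mul_le_mul_of_nonneg_right ?_ (sq_nonneg _))
    have h1 := norm_le_norm_add_norm_sub' Z X
    nlinarith
  · simp only [hZ]
    rw [integral_quadForm D hbound, S.cost_eq hγ hKH D hbound, ← map_sub]
    refine (hcD _).trans ((mul_le_mul_of_nonneg_left hZn' hc).trans ?_)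
    rw [← mul_assoc]
    refine mul_le_mul_of_nonneg_right ?_ (Real.exp_pos _).le
    linarith

end LQProblem

end Frobenius

/-! ### The uniform distribution on the sphere -/

section Sphere

open scoped Pointwise

variable {E : Type*} [NormedAddCommGroup E] [InnerProductSpace ℝ E] [FiniteDimensional ℝ E]
  [MeasurableSpace E] [BorelSpace E]

/-- The surface measure of the unit sphere is invariant under linear isometries. -/
theorem map_toSphere_isometry (T : E ≃ₗᵢ[ℝ] E) :
    Measure.map T (Measure.map Subtype.val (volume : Measure E).toSphere) =
      Measure.map (Subtype.val : Metric.sphere (0 : E) 1 → E) (volume : Measure E).toSphere := by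
  have hT : Measurable T := T.continuous.measurable
  ext s hs
  rw [Measure.map_apply hT hs, Measure.map_apply measurable_subtype_coe (hT hs),
    Measure.map_apply measurable_subtype_coe hs,
    Measure.toSphere_apply' _ (measurable_subtype_coe (hT hs)),
    Measure.toSphere_apply' _ (measurable_subtype_coe hs)]
  congr 1
  have e : Ioo (0 : ℝ) 1 • ((Subtype.val : Metric.sphere (0 : E) 1 → E) ''
      (Subtype.val ⁻¹' (T ⁻¹' s))) =
      T ⁻¹' (Ioo (0 : ℝ) 1 • ((Subtype.val : Metric.sphere (0 : E) 1 → E) ''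
        (Subtype.val ⁻¹' s))) := by
    ext y
    simp only [Subtype.image_preimage_coe, Set.mem_smul, mem_preimage, mem_inter_iff,
      mem_sphere_zero_iff_norm]
    constructor
    · rintro ⟨c, hc, v, ⟨hv, hvs⟩, rfl⟩
      exact ⟨c, hc, T v, ⟨by simpa using hv, hvs⟩, by simp⟩
    · rintro ⟨c, hc, v, ⟨hv, hvs⟩, h⟩
      refine ⟨c, hc, T.symm v, ⟨by simpa using hv, by simpa using hvs⟩, ?_⟩
      apply T.injective
      simp [h]
  rw [e]
  exact T.measurePreserving.measure_preimage_emb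
    T.toHomeomorph.measurableEmbedding _

end Sphere

section UniformSphere

variable {m p : ℕ}

theorem isProbabilityMeasure_uniformSphere (hm : 0 < m) (hp : 0 < p) :
    IsProbabilityMeasure (uniformSphere m p) := by
  have : Nonempty (Fin m × Fin p) := ⟨(⟨0, hm⟩, ⟨0, hp⟩)⟩
  have h0 : (volume : Measure (Gain m p)).toSphere univ ≠ 0 := by
    rw [Measure.measure_univ_ne_zero]
    exact Measure.toSphere_ne_zero _
  constructor
  rw [uniformSphere, Measure.map_apply (by fun_prop) MeasurableSet.univ, preimage_univ,
    Measure.smul_apply, smul_eq_mul, ENNReal.inv_mul_cancel h0 (measure_ne_top _ _)]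

theorem ae_norm_uniformSphere : ∀ᵐ U ∂uniformSphere m p, ‖U‖ = Real.sqrt (m * p) := by
  rw [uniformSphere, ae_map_iff (by fun_prop) (measurableSet_eq_fun (by fun_prop) (by fun_prop))]
  refine ae_of_all _ fun v => ?_
  rw [norm_smul, Real.norm_of_nonneg (Real.sqrt_nonneg _), mem_sphere_zero_iff_norm.1 v.2, mul_one]

theorem measurePreserving_uniformSphere (T : Gain m p ≃ₗᵢ[ℝ] Gain m p) :
    MeasurePreserving T (uniformSphere m p) (uniformSphere m p) := by
  have hT : Measurable T := T.continuous.measurable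
  refine ⟨hT, ?_⟩
  have e : uniformSphere m p = ((volume : Measure (Gain m p)).toSphere univ)⁻¹ •
      Measure.map (fun v : Gain m p => Real.sqrt (m * p) • v)
        (Measure.map (Subtype.val : Metric.sphere (0 : Gain m p) 1 → Gain m p)
          (volume : Measure (Gain m p)).toSphere) := by
    rw [uniformSphere, Measure.map_smul, Measure.map_map (by fun_prop) measurable_subtype_coe]
    rfl
  conv_rhs => rw [e, ← map_toSphere_isometry T]
  rw [e, Measure.map_smul, Measure.map_map hT (by fun_prop), Measure.map_map (by fun_prop) hT]
  congr 2
  ext v : 1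
  simp

theorem memLp_coord_uniformSphere (hm : 0 < m) (hp : 0 < p) (i : Fin m × Fin p) :
    MemLp (fun U : Gain m p => U i) 2 (uniformSphere m p) := by
  have := isProbabilityMeasure_uniformSphere hm hp
  refine MemLp.of_bound (by fun_prop) (Real.sqrt (m * p)) ?_
  filter_upwards [ae_norm_uniformSphere] with U hU
  exact (PiLp.norm_apply_le U i).trans hU.le

theorem integrable_coord_mul_uniformSphere (hm : 0 < m) (hp : 0 < p) (i j : Fin m × Fin p) :
    Integrable (fun U : Gain m p => U i * U j) (uniformSphere m p) :=
  (memLp_coord_uniformSphere hm hp i).integrable_mul (memLp_coord_uniformSphere hm hp j)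

/-- The reflection of the gain space that changes the sign of the coordinate `i`. -/
def coordFlip (i : Fin m × Fin p) : Gain m p ≃ₗᵢ[ℝ] Gain m p :=
  LinearIsometryEquiv.piLpCongrRight 2 fun j =>
    if j = i then LinearIsometryEquiv.neg ℝ else LinearIsometryEquiv.refl ℝ ℝ

theorem coordFlip_apply (i j : Fin m × Fin p) (U : Gain m p) :
    coordFlip i U j = if j = i then -U j else U j := by
  simp only [coordFlip, LinearIsometryEquiv.piLpCongrRight_apply]
  split_ifs <;> simp

theorem integral_comp_isometry_uniformSphere (T : Gain m p ≃ₗᵢ[ℝ] Gain m p) (f : Gain m p → ℝ) :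
    ∫ U, f (T U) ∂uniformSphere m p = ∫ U, f U ∂uniformSphere m p :=
  (measurePreserving_uniformSphere T).integral_comp T.toHomeomorph.measurableEmbedding f

theorem integral_coord_uniformSphere (i : Fin m × Fin p) :
    ∫ U, U i ∂uniformSphere m p = 0 := by
  have h := integral_comp_isometry_uniformSphere (coordFlip i) fun U => U i
  simp only [coordFlip_apply, if_true, integral_neg] at h
  linarith

theorem integral_coord_mul_coord_of_ne {i j : Fin m × Fin p} (hij : i ≠ j) :
    ∫ U, U i * U j ∂uniformSphere m p = 0 := by
  have h := integral_comp_isometry_uniformSphere (coordFlip i) fun U => U i * U j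
  simp only [coordFlip_apply, if_true, hij.symm, if_false, neg_mul, integral_neg] at h
  linarith

theorem integral_coord_sq (hm : 0 < m) (hp : 0 < p) (i : Fin m × Fin p) :
    ∫ U, U i * U i ∂uniformSphere m p = 1 := by
  have := isProbabilityMeasure_uniformSphere hm hp
  have hswap : ∀ j, ∫ U, U j * U j ∂uniformSphere m p = ∫ U, U i * U i ∂uniformSphere m p := by
    intro j
    have h := integral_comp_isometry_uniformSphere
      (LinearIsometryEquiv.piLpCongrLeft 2 ℝ ℝ (Equiv.swap i j)) fun U => U i * U i
    simpa [LinearIsometryEquiv.piLpCongrLeft_apply, Equiv.piCongrLeft'_apply] using h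
  have hsum : ∑ j, ∫ U, U j * U j ∂uniformSphere m p = (m * p : ℝ) := by
    rw [← integral_finsetSum _ fun j _ => integrable_coord_mul_uniformSphere hm hp j j]
    have : ∀ᵐ U ∂uniformSphere m p, ∑ j, U j * U j = (m * p : ℝ) := by
      filter_upwards [ae_norm_uniformSphere] with U hU
      have h1 := EuclideanSpace.norm_sq_eq U
      rw [hU, Real.sq_sqrt (by positivity)] at h1
      rw [h1]
      simp [sq]
    rw [integral_congr_ae this]
    simp
  rw [Finset.sum_congr rfl fun j _ => hswap j, Finset.sum_const, Finset.card_univ,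
    Fintype.card_prod, Fintype.card_fin, Fintype.card_fin, nsmul_eq_mul, Nat.cast_mul] at hsum
  have hmp : (m * p : ℝ) ≠ 0 := by positivity
  exact (mul_eq_left₀ hmp).1 hsum

/-- The covariance of the uniform distribution on the sphere of radius `√(m p)` is the
identity. -/
theorem integral_inner_mul_coord (hm : 0 < m) (hp : 0 < p) (g : Gain m p) (i : Fin m × Fin p) :
    ∫ U, inner ℝ g U * U i ∂uniformSphere m p = g i := by
  have e : ∀ U : Gain m p, inner ℝ g U * U i = ∑ j, g j * (U j * U i) := fun U => by
    simp only [PiLp.inner_apply, Finset.sum_mul]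
    exact Finset.sum_congr rfl fun j _ => by simp; ring
  simp only [e]
  rw [integral_finsetSum _ fun j _ =>
    (integrable_coord_mul_uniformSphere hm hp j i).const_mul (g j)]
  simp only [integral_const_mul]
  rw [Finset.sum_eq_single i, integral_coord_sq hm hp, mul_one]
  · intro j _ hj
    rw [integral_coord_mul_coord_of_ne hj, mul_zero]
  · simp

end UniformSphere

/-! ### Hoeffding's inequality for independent copies -/

section Hoeffding

open ProbabilityTheory

/-- Hoeffding's inequality for the average of `N` independent copies of a bounded variable. -/
theorem measureReal_abs_average_sub_ge_le {Ω : Type*} [MeasurableSpace Ω] (μ : Measure Ω)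
    [IsProbabilityMeasure μ] {Y : Ω → ℝ} (hY : AEMeasurable Y μ) {b : ℝ} (hb : 0 < b)
    (hYb : ∀ᵐ ω ∂μ, |Y ω| ≤ b) {N : ℕ} (hN : 0 < N) {s : ℝ} (hs : 0 ≤ s) :
    (Measure.pi fun _ : Fin N => μ).real {ω | s ≤ |(1 / N : ℝ) * ∑ k, Y (ω k) - ∫ x, Y x ∂μ|} ≤
      2 * Real.exp (-(N * s ^ 2 / (2 * b ^ 2))) := by
  have hN' : (0 : ℝ) < N := by exact_mod_cast hN
  set e := ∫ x, Y x ∂μ with he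
  have hsub : HasSubgaussianMGF (fun x => Y x - e) ((‖b - -b‖₊ / 2) ^ 2) μ :=
    hasSubgaussianMGF_of_mem_Icc hY (by
      filter_upwards [hYb] with x hx
      exact abs_le.1 hx)
  have hone : ∀ (σ : ℝ), σ = 1 ∨ σ = -1 →
      (Measure.pi fun _ : Fin N => μ).real {ω | N * s ≤ ∑ k, σ * (Y (ω k) - e)} ≤
        Real.exp (-(N * s ^ 2 / (2 * b ^ 2))) := by
    intro σ hσ
    have hsubσ : HasSubgaussianMGF (fun x => σ * (Y x - e)) ((‖b - -b‖₊ / 2) ^ 2) μ := by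
      rcases hσ with rfl | rfl
      · simpa using hsub
      · have e1 : (fun x => (-1) * (Y x - e)) = -fun x => Y x - e := by ext x; simp
        rw [e1]
        exact hsub.neg
    have hk : ∀ k : Fin N, HasSubgaussianMGF (fun ω : Fin N → Ω => σ * (Y (ω k) - e))
        ((‖b - -b‖₊ / 2) ^ 2) (Measure.pi fun _ : Fin N => μ) := by
      intro k
      have hmp := measurePreserving_eval (fun _ : Fin N => μ) k
      exact HasSubgaussianMGF.of_map (Y := Function.eval k) hmp.measurable.aemeasurable
        (by rw [hmp.map_eq]; exact hsubσ)
    have hind : iIndepFun (fun (k : Fin N) (ω : Fin N → Ω) => σ * (Y (ω k) - e))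
        (Measure.pi fun _ : Fin N => μ) :=
      iIndepFun_pi (X := fun _ x => σ * (Y x - e)) fun _ => (hY.sub_const e).const_mul σ
    have := HasSubgaussianMGF.measure_sum_ge_le_of_iIndepFun hind (s := Finset.univ)
      (fun k _ => hk k) (ε := N * s) (by positivity)
    refine this.trans (le_of_eq ?_)
    congr 1
    have hc : (((‖b - -b‖₊ / 2) ^ 2 : NNReal) : ℝ) = b ^ 2 := by
      push_cast
      rw [sub_neg_eq_add, Real.norm_of_nonneg (by linarith)]
      ring
    simp only [Finset.sum_const, Finset.card_univ, Fintype.card_fin, nsmul_eq_mul]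
    push_cast at hc ⊢
    rw [hc]
    field_simp
  have hsubset : {ω : Fin N → Ω | s ≤ |(1 / N : ℝ) * ∑ k, Y (ω k) - e|} ⊆
      {ω | N * s ≤ ∑ k, 1 * (Y (ω k) - e)} ∪ {ω | N * s ≤ ∑ k, -1 * (Y (ω k) - e)} := by
    intro ω hω
    have e1 : ∑ k, (Y (ω k) - e) = N * ((1 / N : ℝ) * ∑ k, Y (ω k) - e) := by
      rw [Finset.sum_sub_distrib, Finset.sum_const, Finset.card_univ, Fintype.card_fin,
        nsmul_eq_mul]
      field_simp
    have e2 : ∑ k, -1 * (Y (ω k) - e) = N * -((1 / N : ℝ) * ∑ k, Y (ω k) - e) := by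
      rw [← Finset.mul_sum, e1]; ring
    simp only [one_mul]
    rcases le_abs'.1 (show s ≤ |(1 / N : ℝ) * ∑ k, Y (ω k) - e| from hω) with h | h
    · right
      change (N : ℝ) * s ≤ ∑ k, -1 * (Y (ω k) - e)
      rw [e2]
      exact mul_le_mul_of_nonneg_left (by linarith) hN'.le
    · left
      change (N : ℝ) * s ≤ ∑ k, (Y (ω k) - e)
      rw [e1]
      exact mul_le_mul_of_nonneg_left h hN'.le
  refine (measureReal_mono hsubset).trans ((measureReal_union_le _ _).trans ?_)
  have h1 := hone 1 (Or.inl rfl)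
  have h2 := hone (-1) (Or.inr rfl)
  linarith

end Hoeffding

/-! ### The gradient estimate -/

theorem norm_le_of_forall_abs_le {ι : Type*} [Fintype ι] [Nonempty ι] (v : EuclideanSpace ℝ ι)
    {s : ℝ} (hs : 0 ≤ s) (hv : ∀ i, |v i| ≤ s) : ‖v‖ ≤ Fintype.card ι * s := by
  have hc : (1 : ℝ) ≤ Fintype.card ι := by exact_mod_cast Fintype.card_pos
  refine le_of_sq_le_sq ?_ (by positivity)
  rw [EuclideanSpace.norm_sq_eq]
  calc ∑ i, ‖v i‖ ^ 2 ≤ ∑ _i : ι, s ^ 2 :=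
        Finset.sum_le_sum fun i _ => pow_le_pow_left₀ (norm_nonneg _) (hv i) 2
    _ = Fintype.card ι * s ^ 2 := by simp
    _ ≤ (Fintype.card ι * s) ^ 2 := by
        rw [mul_pow]
        exact mul_le_mul_of_nonneg_right (by nlinarith) (sq_nonneg s)

theorem exp_neg_max_log_le_min {ε : ℝ} (hε : 0 < ε) :
    Real.exp (-(max (Real.log (1 / ε)) 1)) ≤ min ε 1 := by
  refine le_min ?_ (Real.exp_le_one_iff.2 ?_)
  · have h := le_max_left (Real.log (1 / ε)) 1
    rw [one_div, Real.log_inv] at h ⊢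
    calc Real.exp (-(max (-Real.log ε) 1)) ≤ Real.exp (Real.log ε) :=
          Real.exp_le_exp.2 (by linarith)
      _ = ε := Real.exp_log hε
  · have h := le_max_right (Real.log (1 / ε)) 1
    linarith

/-- The truncation error `L exp (-β τ)`, amplified by `q / r`, is at most `ε / (4 d)` for
`τ` of order `log (1 / ε)` and `r` of order `ε`. -/
theorem mul_exp_neg_mul_le {ε d q c L β r τ : ℝ} (hε : 0 < ε) (hd : 0 < d) (hq : 0 < q)
    (hc : 0 < c) (hL : 0 ≤ L) (hβ : 0 < β) (hcr : c * min ε 1 ≤ r)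
    (hτ : (2 + |Real.log (c / (4 * d * q * (L + 1)))|) / β * max (Real.log (1 / ε)) 1 ≤ τ) :
    L * Real.exp (-(β * τ)) * q ≤ r * (ε / (4 * d)) := by
  set k := c / (4 * d * q * (L + 1)) with hk
  have hk0 : 0 < k := by positivity
  set μ := min ε 1
  have hμ0 : 0 < μ := lt_min hε one_pos
  have hμε : μ ≤ ε := min_le_left _ _
  have hr0 : 0 < r := lt_of_lt_of_le (by positivity) hcr
  set M := max (Real.log (1 / ε)) 1 with hM
  have hM1 : 1 ≤ M := le_max_right _ _
  have h1 : (2 + |Real.log k|) * M ≤ β * τ := by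
    refine le_trans (le_of_eq ?_) (mul_le_mul_of_nonneg_left hτ hβ.le)
    field_simp
  have h2 : Real.exp (-(β * τ)) ≤ μ ^ 2 * k := by
    have h3 : Real.exp (-(β * τ)) ≤ Real.exp (-M) ^ 2 * Real.exp (-|Real.log k|) := by
      rw [← Real.exp_nat_mul, ← Real.exp_add, Real.exp_le_exp]
      have : |Real.log k| ≤ |Real.log k| * M := le_mul_of_one_le_right (abs_nonneg _) hM1
      push_cast
      linarith
    refine h3.trans (mul_le_mul ?_ ?_ (Real.exp_pos _).le (by positivity))
    · exact pow_le_pow_left₀ (Real.exp_pos _).le (exp_neg_max_log_le_min hε) 2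
    · calc Real.exp (-|Real.log k|) ≤ Real.exp (Real.log k) := Real.exp_le_exp.2 (neg_abs_le _)
        _ = k := Real.exp_log hk0
  have h4 : L * q * (μ ^ 2 * k) ≤ c * μ * (μ / (4 * d)) := by
    have e : L * q * (μ ^ 2 * k) = L / (L + 1) * (c * μ * (μ / (4 * d))) := by
      rw [hk]; field_simp
    rw [e]
    exact mul_le_of_le_one_left (by positivity) ((div_le_one (by positivity)).2 (by linarith))
  have h5 : c * μ * (μ / (4 * d)) ≤ r * (ε / (4 * d)) := by gcongr
  have h6 := mul_le_mul_of_nonneg_left h2 (show 0 ≤ L * q by positivity)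
  linarith

/-- The sum of the Hoeffding bounds of all coordinates is less than `δ` for `N` of order
`log (1 / δ) / ε⁴`: two of the powers of `ε` come from the accuracy and two from the size `1 / r`
of the samples. -/
theorem mul_two_mul_exp_neg_lt {ε δ d q c B r N : ℝ} (hε : 0 < ε) (hδ : 0 < δ) (hd : 1 ≤ d)
    (hq : q ^ 2 = d) (hc : 0 < c) (hB : 0 < B) (hcr : c * min ε 1 ≤ r)
    (hN : (Real.log (2 * d) + 2) / (c ^ 2 / (8 * d ^ 3 * B ^ 2)) *
      (max (Real.log (1 / δ)) 1 / (min ε 1) ^ 4) ≤ N) :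
    d * (2 * Real.exp (-(N * (ε / (2 * d)) ^ 2 / (2 * (B * q / r) ^ 2)))) < δ := by
  set lam := c ^ 2 / (8 * d ^ 3 * B ^ 2) with hlam
  have hlam0 : 0 < lam := by positivity
  have hlog : 0 < Real.log (2 * d) := Real.log_pos (by linarith)
  set μ := min ε 1
  have hμ0 : 0 < μ := lt_min hε one_pos
  have hμε : μ ≤ ε := min_le_left _ _
  have hr0 : 0 < r := lt_of_lt_of_le (by positivity) hcr
  have hMl : -Real.log δ ≤ max (Real.log (1 / δ)) 1 := by
    rw [one_div, Real.log_inv]; exact le_max_left _ _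
  have hM1 : 1 ≤ max (Real.log (1 / δ)) 1 := le_max_right _ _
  generalize max (Real.log (1 / δ)) 1 = M at hMl hM1 hN
  have hN0 : 0 ≤ N := le_trans (by positivity) hN
  have hq0 : q ≠ 0 := by rintro rfl; norm_num at hq; linarith
  have hexpo : (Real.log (2 * d) + 2) * M ≤
      N * (ε / (2 * d)) ^ 2 / (2 * (B * q / r) ^ 2) := by
    have e1 : N * (ε / (2 * d)) ^ 2 / (2 * (B * q / r) ^ 2) =
        N * (ε * r) ^ 2 / (8 * d ^ 3 * B ^ 2) := by
      rw [div_pow _ r, mul_pow _ q, hq]; field_simp; ring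
    have h1 : (Real.log (2 * d) + 2) * M ≤ lam * (N * μ ^ 4) := by
      have h2 := mul_le_mul_of_nonneg_right hN (show 0 ≤ lam * μ ^ 4 by positivity)
      refine le_trans (le_of_eq ?_) (h2.trans (le_of_eq (by ring)))
      field_simp
    refine h1.trans ?_
    rw [e1, hlam, div_mul_eq_mul_div]
    refine div_le_div_of_nonneg_right ?_ (by positivity)
    have h3 : c * μ ^ 2 ≤ ε * r := by
      calc c * μ ^ 2 = μ * (c * μ) := by ring
        _ ≤ ε * r := mul_le_mul hμε hcr (by positivity) hε.le
    calc c ^ 2 * (N * μ ^ 4) = N * (c * μ ^ 2) ^ 2 := by ring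
      _ ≤ N * (ε * r) ^ 2 := by gcongr
  calc d * (2 * Real.exp (-(N * (ε / (2 * d)) ^ 2 / (2 * (B * q / r) ^ 2)))) ≤
        d * (2 * Real.exp (-((Real.log (2 * d) + 2) * M))) := by gcongr
    _ = Real.exp (Real.log (2 * d) - (Real.log (2 * d) + 2) * M) := by
        rw [sub_eq_add_neg, Real.exp_add, Real.exp_log (by positivity)]; ring
    _ < Real.exp (Real.log δ) := by
        rw [Real.exp_lt_exp, add_mul]
        have := mul_le_mul_of_nonneg_left hM1 hlog.le
        linarith
    _ = δ := Real.exp_log hδ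

namespace LQProblem

variable {n m p : ℕ} (S : LQProblem n m p)

theorem continuous_runningCost : Continuous fun q : (Gain m p × EuclideanSpace ℝ (Fin n)) × ℝ =>
    S.runningCost q.1.1 q.1.2 q.2 := by
  have hmat : Continuous (Gain.mat : Gain m p → Matrix (Fin m) (Fin p) ℝ) :=
    continuous_matrix fun i j => by unfold Gain.mat; dsimp; fun_prop
  have hcl : Continuous (S.closedLoop) :=
    continuous_const.sub ((continuous_const.matrix_mul hmat).matrix_mul continuous_const)
  have hx : Continuous fun q : (Gain m p × EuclideanSpace ℝ (Fin n)) × ℝ =>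
      S.state q.1.1 q.1.2 q.2 :=
    ((continuous_matrix_exp n).comp (continuous_snd.smul (hcl.comp
      (continuous_fst.comp continuous_fst)))).matrix_mulVec (by fun_prop)
  have hy : Continuous fun q : (Gain m p × EuclideanSpace ℝ (Fin n)) × ℝ =>
      S.output q.1.1 q.1.2 q.2 := continuous_const.matrix_mulVec hx
  have hu : Continuous fun q : (Gain m p × EuclideanSpace ℝ (Fin n)) × ℝ =>
      S.input q.1.1 q.1.2 q.2 :=
    ((hmat.comp (continuous_fst.comp continuous_fst)).matrix_mulVec hy).neg
  exact (hy.dotProduct (continuous_const.matrix_mulVec hy)).add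
    (hu.dotProduct (continuous_const.matrix_mulVec hu))

theorem continuous_simulatedCost (τ : ℝ) :
    Continuous fun q : Gain m p × EuclideanSpace ℝ (Fin n) => S.simulatedCost τ q.1 q.2 :=
  intervalIntegral.continuous_parametric_intervalIntegral_of_continuous'
    (f := fun (q : Gain m p × EuclideanSpace ℝ (Fin n)) t => S.runningCost q.1 q.2 t)
    S.continuous_runningCost 0 τ

/-- The coordinate `i` of the contribution of one sample to the gradient estimate. -/
def sampleCoord (r τ : ℝ) (K : Gain m p) (i : Fin m × Fin p)
    (z : Gain m p × EuclideanSpace ℝ (Fin n)) : ℝ :=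
  S.simulatedCost τ (K + r • z.1) z.2 * z.1 i / r

theorem continuous_sampleCoord (r τ : ℝ) (K : Gain m p) (i : Fin m × Fin p) :
    Continuous (S.sampleCoord r τ K i) := by
  have h : Continuous fun z : Gain m p × EuclideanSpace ℝ (Fin n) =>
      S.simulatedCost τ (K + r • z.1) z.2 :=
    (S.continuous_simulatedCost τ).comp (f := fun z : Gain m p × EuclideanSpace ℝ (Fin n) =>
      (K + r • z.1, z.2)) (by fun_prop)
  have h2 : Continuous fun z : Gain m p × EuclideanSpace ℝ (Fin n) => z.1 i := by fun_prop
  exact (h.mul h2).div_const r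

theorem gradEstimate_apply (r τ : ℝ) {N : ℕ} (K : Gain m p)
    (ω : Fin N → Gain m p × EuclideanSpace ℝ (Fin n)) (i : Fin m × Fin p) :
    S.gradEstimate r τ K ω i = (1 / N : ℝ) * ∑ k, S.sampleCoord r τ K i (ω k) := by
  simp only [gradEstimate, sampleCoord, PiLp.smul_apply, WithLp.ofLp_sum, Finset.sum_apply,
    WithLp.ofLp_smul, Pi.smul_apply, smul_eq_mul, ← Finset.sum_div]
  rw [one_div, one_div, mul_inv, div_eq_mul_inv]
  ring

section Estimate

variable (hm : 0 < m) (hp : 0 < p) (D : Measure (EuclideanSpace ℝ (Fin n)))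
  {P : ℝ} (hbound : ∀ᵐ x ∂D, ‖x‖ ≤ P) {r τ B : ℝ} (hr : 0 < r)
  {K g : Gain m p}
  (hB : ∀ U : Gain m p, ‖U‖ = Real.sqrt (m * p) →
    ∀ x, |S.simulatedCost τ (K + r • U) x| ≤ B * ‖x‖ ^ 2)
include hm hp hbound hr hB

theorem ae_abs_sampleCoord_le (hB0 : 0 ≤ B) (i : Fin m × Fin p) :
    ∀ᵐ z ∂(uniformSphere m p).prod D,
      |S.sampleCoord r τ K i z| ≤ B * P ^ 2 * Real.sqrt (m * p) / r := by
  have := isProbabilityMeasure_uniformSphere hm hp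
  have h1 : ∀ᵐ z ∂(uniformSphere m p).prod D, ‖z.1‖ = Real.sqrt (m * p) :=
    Measure.quasiMeasurePreserving_fst.ae ae_norm_uniformSphere
  have h2 : ∀ᵐ z ∂(uniformSphere m p).prod D, ‖z.2‖ ≤ P :=
    Measure.quasiMeasurePreserving_snd.ae hbound
  filter_upwards [h1, h2] with z hz1 hz2
  rw [sampleCoord, abs_div, abs_of_pos hr, abs_mul]
  refine div_le_div_of_nonneg_right (mul_le_mul ?_ ?_ (abs_nonneg _) (by positivity)) hr.le
  · refine (hB z.1 hz1 z.2).trans (mul_le_mul_of_nonneg_left ?_ hB0)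
    exact pow_le_pow_left₀ (norm_nonneg _) hz2 2
  · exact (PiLp.norm_apply_le z.1 i).trans hz1.le

variable [IsProbabilityMeasure D]

/-- The bias of the gradient estimate: as the direction has mean zero and identity covariance, only
the error of the first order model `c₀ + r ⟪g, U⟫` of the expected truncated cost contributes. -/
theorem abs_integral_sampleCoord_sub_le (hB0 : 0 ≤ B) {c₀ η : ℝ}
    (hη : ∀ U : Gain m p, ‖U‖ = Real.sqrt (m * p) →
      |∫ x, S.simulatedCost τ (K + r • U) x ∂D - c₀ - r * inner ℝ g U| ≤ η)
    (i : Fin m × Fin p) :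
    |∫ z, S.sampleCoord r τ K i z ∂(uniformSphere m p).prod D - g i| ≤
      η * Real.sqrt (m * p) / r := by
  have := isProbabilityMeasure_uniformSphere hm hp
  have hint : Integrable (S.sampleCoord r τ K i) ((uniformSphere m p).prod D) :=
    Integrable.of_bound (S.continuous_sampleCoord r τ K i).aestronglyMeasurable
      (B * P ^ 2 * Real.sqrt (m * p) / r) (S.ae_abs_sampleCoord_le hm hp D hbound hr hB hB0 i)
  have hUi : Integrable (fun U : Gain m p => U i) (uniformSphere m p) :=
    (memLp_coord_uniformSphere hm hp i).integrable one_le_two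
  have hgU : Integrable (fun U : Gain m p => inner ℝ g U * U i) (uniformSphere m p) := by
    have e : (fun U : Gain m p => inner ℝ g U * U i) = fun U => ∑ j, g j * (U j * U i) := by
      ext U
      simp only [PiLp.inner_apply, Finset.sum_mul]
      exact Finset.sum_congr rfl fun j _ => by simp; ring
    rw [e]
    exact integrable_finsetSum _ fun j _ =>
      (integrable_coord_mul_uniformSphere hm hp j i).const_mul (g j)
  set h : Gain m p → ℝ := fun U => ∫ x, S.simulatedCost τ (K + r • U) x ∂D with hh
  have e1 : ∀ U, ∫ x, S.sampleCoord r τ K i (U, x) ∂D = h U * U i / r := fun U => by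
    simp only [sampleCoord, integral_div, integral_mul_const, hh]
  have hhint : Integrable (fun U => h U * U i / r) (uniformSphere m p) := by
    have := hint.integral_prod_left
    simpa only [e1] using this
  have e2 : ∫ z, S.sampleCoord r τ K i z ∂(uniformSphere m p).prod D =
      ∫ U, h U * U i / r ∂uniformSphere m p := by
    rw [integral_prod _ hint]
    simp only [e1]
  have e3 : ∫ U, (h U - c₀ - r * inner ℝ g U) * U i / r ∂uniformSphere m p =
      ∫ U, h U * U i / r ∂uniformSphere m p - g i := by
    have e4 : (fun U : Gain m p => (h U - c₀ - r * inner ℝ g U) * U i / r) = fun U =>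
        h U * U i / r - (c₀ / r) * U i - inner ℝ g U * U i := by
      ext U; field_simp
    rw [e4]
    refine (integral_sub (hhint.sub (hUi.const_mul (c₀ / r))) hgU).trans ?_
    rw [integral_inner_mul_coord hm hp]
    refine congrArg (· - g i) ((integral_sub hhint (hUi.const_mul (c₀ / r))).trans ?_)
    rw [integral_const_mul, integral_coord_uniformSphere, mul_zero, sub_zero]
  rw [e2, ← e3]
  have hfin := norm_integral_le_of_norm_le_const (μ := uniformSphere m p)
    (f := fun U => (h U - c₀ - r * inner ℝ g U) * U i / r) (C := η * Real.sqrt (m * p) / r) (by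
      filter_upwards [ae_norm_uniformSphere] with U hU
      rw [Real.norm_eq_abs, abs_div, abs_of_pos hr, abs_mul]
      refine div_le_div_of_nonneg_right (mul_le_mul (hη U hU) ?_ (abs_nonneg _)
        ((abs_nonneg _).trans (hη U hU))) hr.le
      exact (PiLp.norm_apply_le U i).trans hU.le)
  simpa using hfin

/-- A bias of at most `s` in each coordinate and Hoeffding's inequality for each coordinate bound
the probability of an error larger than `2 m p s`. -/
theorem measureReal_lt_norm_gradEstimate_sub_le (hP : 0 < P) (hB0 : 0 < B) {c₀ η s : ℝ}
    (hη : ∀ U : Gain m p, ‖U‖ = Real.sqrt (m * p) →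
      |∫ x, S.simulatedCost τ (K + r • U) x ∂D - c₀ - r * inner ℝ g U| ≤ η)
    (hs : 0 ≤ s) (hηs : η * Real.sqrt (m * p) / r ≤ s) {N : ℕ} (hN : 0 < N) :
    (sampleLaw m p D N).real {ω | m * p * (2 * s) < ‖S.gradEstimate r τ K ω - g‖} ≤
      m * p * (2 * Real.exp (-(N * s ^ 2 /
        (2 * (B * P ^ 2 * Real.sqrt (m * p) / r) ^ 2)))) := by
  have := isProbabilityMeasure_uniformSphere hm hp
  have : Nonempty (Fin m × Fin p) := ⟨(⟨0, hm⟩, ⟨0, hp⟩)⟩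
  have hcard : (Fintype.card (Fin m × Fin p) : ℝ) = m * p := by simp
  have hb : 0 < B * P ^ 2 * Real.sqrt (m * p) / r := by positivity
  set e : Fin m × Fin p → ℝ := fun i =>
    ∫ z, S.sampleCoord r τ K i z ∂(uniformSphere m p).prod D with he
  have hsub : {ω : Fin N → Gain m p × EuclideanSpace ℝ (Fin n) |
      m * p * (2 * s) < ‖S.gradEstimate r τ K ω - g‖} ⊆
      ⋃ i ∈ (Finset.univ : Finset (Fin m × Fin p)),
        {ω | s ≤ |(1 / N : ℝ) * ∑ k, S.sampleCoord r τ K i (ω k) - e i|} := by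
    intro ω hω
    by_contra hcon
    refine absurd (show m * p * (2 * s) < ‖S.gradEstimate r τ K ω - g‖ from hω) (not_lt.2 ?_)
    rw [← hcard]
    refine norm_le_of_forall_abs_le _ (by positivity) fun i => ?_
    have h1 : |(1 / N : ℝ) * ∑ k, S.sampleCoord r τ K i (ω k) - e i| < s := by
      by_contra h
      exact hcon (mem_iUnion₂.2 ⟨i, Finset.mem_univ i, not_lt.1 h⟩)
    have h2 := (S.abs_integral_sampleCoord_sub_le hm hp D hbound hr hB hB0.le hη i).trans hηs
    rw [PiLp.sub_apply, gradEstimate_apply]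
    have h3 := abs_sub_le ((1 / N : ℝ) * ∑ k, S.sampleCoord r τ K i (ω k)) (e i) (g i)
    linarith
  have : IsProbabilityMeasure (sampleLaw m p D N) := by unfold sampleLaw; infer_instance
  refine (measureReal_mono hsub (measure_ne_top _ _)).trans
    ((measureReal_biUnion_finset_le _ _).trans ?_)
  refine (Finset.sum_le_sum fun i _ => measureReal_abs_average_sub_ge_le _
    (S.continuous_sampleCoord r τ K i).aestronglyMeasurable.aemeasurable hb
    (S.ae_abs_sampleCoord_le hm hp D hbound hr hB hB0.le i) hN hs).trans (le_of_eq ?_)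
  rw [Finset.sum_const, Finset.card_univ, nsmul_eq_mul, hcard]

end Estimate

end LQProblem

end OutputFeedback

end

theorem mainTheorem2 {n m p : ℕ} (hm : 0 < m) (hp : 0 < p)
    (S : OutputFeedback.LQProblem n m p) (hQ : S.Q.PosDef) (hR : S.R.PosDef)
    (D : MeasureTheory.Measure (EuclideanSpace ℝ (Fin n)))
    [MeasureTheory.IsProbabilityMeasure D]
    (hSigma : (OutputFeedback.secondMoment D).PosDef)
    (P : ℝ) (hP : 0 < P) (hbound : ∀ᵐ x ∂D, ‖x‖ ≤ P) (a : ℝ) :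
    ∃ ρ : ℝ, 0 < ρ ∧ ∀ c : ℝ, 0 < c → c ≤ ρ →
      ∃ cτ cN : ℝ, 0 < cτ ∧ 0 < cN ∧
        ∀ ε δ : ℝ, 0 < ε → 0 < δ →
        ∀ (r τ : ℝ) (N : ℕ),
          c * min ε 1 ≤ r → r ≤ ρ * min ε 1 →
          cτ * max (Real.log (1 / ε)) 1 ≤ τ →
          cN * (max (Real.log (1 / δ)) 1 / (min ε 1) ^ 4) ≤ (N : ℝ) →
          ∀ K ∈ S.sublevel D a,
            DifferentiableAt ℝ (S.cost D) K ∧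
            1 - δ < (OutputFeedback.sampleLaw m p D N).real
              {ω | ‖S.gradEstimate r τ K ω - gradient (S.cost D) K‖ ≤ ε} := by
  have := OutputFeedback.isProbabilityMeasure_uniformSphere hm hp
  obtain ⟨ρ₁, L₁, hρ₁, hL₁, hexp⟩ := S.exists_cost_expansion D hbound hQ hR hSigma a
  obtain ⟨ρ₂, L₂, β, hρ₂, hL₂, hβ, hsim⟩ := S.exists_simulatedCost_bounds D hbound hQ hR hSigma a
  have hm1 : (1 : ℝ) ≤ m := by exact_mod_cast hm
  have hp1 : (1 : ℝ) ≤ p := by exact_mod_cast hp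
  set d : ℝ := m * p with hd
  have hd1 : 1 ≤ d := by nlinarith
  have hd0 : 0 < d := by linarith
  set q := Real.sqrt d with hq
  have hq0 : 0 < q := Real.sqrt_pos.2 hd0
  have hq2 : q ^ 2 = d := Real.sq_sqrt hd0.le
  -- The bias `L₁ r d q` of the finite difference has to stay below `ε / (4 d)`.
  refine ⟨min (min ρ₁ ρ₂ / q) (1 / (4 * d ^ 2 * q * (L₁ + 1))), by positivity, fun c hc hcρ => ?_⟩
  have hlog : 0 < Real.log (2 * d) := Real.log_pos (by linarith)
  refine ⟨(2 + |Real.log (c / (4 * d * q * (L₂ + 1)))|) / β,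
    (Real.log (2 * d) + 2) / (c ^ 2 / (8 * d ^ 3 * ((L₂ + 1) * P ^ 2) ^ 2)), by positivity,
    by positivity, fun ε δ hε hδ r τ N hcr hrρ hτ hN K hK => ?_⟩
  set μ₁ := min ε 1 with hμ₁
  have hμ0 : 0 < μ₁ := lt_min hε one_pos
  have hμε : μ₁ ≤ ε := min_le_left _ _
  have hμ1 : μ₁ ≤ 1 := min_le_right _ _
  have hr0 : 0 < r := lt_of_lt_of_le (by positivity) hcr
  have hτ0 : 0 ≤ τ := le_trans (by positivity) hτ
  have hN0 : 0 < N := by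
    have : (0 : ℝ) < N := lt_of_lt_of_le (by positivity) hN
    exact_mod_cast this
  have hrρ' : r * q ≤ min ρ₁ ρ₂ := by
    rw [← le_div_iff₀ hq0]
    refine hrρ.trans (le_trans ?_ (min_le_left _ (1 / (4 * d ^ 2 * q * (L₁ + 1)))))
    exact mul_le_of_le_one_right (by positivity) hμ1
  have hbias : L₁ * r * d * q ≤ ε / (4 * d) := by
    have h1 : r ≤ 1 / (4 * d ^ 2 * q * (L₁ + 1)) * ε :=
      hrρ.trans (mul_le_mul (min_le_right _ _) hμε hμ0.le (by positivity))
    rw [one_div_mul_eq_div, le_div_iff₀ (by positivity)] at h1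
    rw [le_div_iff₀ (by positivity)]
    have h2 : 0 ≤ r * (4 * d ^ 2 * q) := by positivity
    linarith
  have htrunc : L₂ * Real.exp (-(β * τ)) * q ≤ r * (ε / (4 * d)) :=
    OutputFeedback.mul_exp_neg_mul_le hε hd0 hq0 hc hL₂ hβ hcr hτ
  obtain ⟨g, hg⟩ := hexp K hK
  have hgrad : HasGradientAt (S.cost D) g K :=
    OutputFeedback.hasGradientAt_of_abs_sub_le hρ₁ hg
  refine ⟨hgrad.differentiableAt, ?_⟩
  rw [hgrad.gradient]
  have hUnorm : ∀ U : OutputFeedback.Gain m p, ‖U‖ = q → ‖r • U‖ = r * q := fun U hU => by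
    rw [norm_smul, hU, Real.norm_of_nonneg hr0.le]
  -- Hoeffding's inequality needs a strictly positive bound, hence `L₂ + 1`.
  have hB : ∀ U : OutputFeedback.Gain m p, ‖U‖ = Real.sqrt (m * p) →
      ∀ x, |S.simulatedCost τ (K + r • U) x| ≤ (L₂ + 1) * ‖x‖ ^ 2 := fun U hU x => by
    have h1 := (hsim K hK (r • U) ((hUnorm U hU).trans_le
      (hrρ'.trans (min_le_right _ _))) τ hτ0).1 x
    nlinarith [sq_nonneg ‖x‖]
  have hη : ∀ U : OutputFeedback.Gain m p, ‖U‖ = Real.sqrt (m * p) →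
      |∫ x, S.simulatedCost τ (K + r • U) x ∂D - S.cost D K - r * inner ℝ g U| ≤
        L₂ * Real.exp (-(β * τ)) + L₁ * (r * q) ^ 2 := fun U hU => by
    have h1 := (hsim K hK (r • U) ((hUnorm U hU).trans_le
      (hrρ'.trans (min_le_right _ _))) τ hτ0).2
    have h2 := hg (r • U) ((hUnorm U hU).trans_le (hrρ'.trans (min_le_left _ _)))
    rw [hUnorm U hU, inner_smul_right] at h2
    have h3 := abs_add_le (∫ x, S.simulatedCost τ (K + r • U) x ∂D - S.cost D (K + r • U))
      (S.cost D (K + r • U) - S.cost D K - r * inner ℝ g U)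
    rw [show ∫ x, S.simulatedCost τ (K + r • U) x ∂D - S.cost D (K + r • U) +
      (S.cost D (K + r • U) - S.cost D K - r * inner ℝ g U) =
      ∫ x, S.simulatedCost τ (K + r • U) x ∂D - S.cost D K - r * inner ℝ g U by ring] at h3
    linarith
  have hηs : (L₂ * Real.exp (-(β * τ)) + L₁ * (r * q) ^ 2) * Real.sqrt (m * p) / r ≤
      ε / (2 * d) := by
    change (L₂ * Real.exp (-(β * τ)) + L₁ * (r * q) ^ 2) * q / r ≤ _
    rw [div_le_iff₀ hr0]
    have h1 := mul_le_mul_of_nonneg_left hbias hr0.le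
    have e1 : L₁ * (r * q) ^ 2 * q = r * (L₁ * r * d * q) := by rw [mul_pow, hq2]; ring
    have e2 : ε / (2 * d) * r = r * (ε / (4 * d)) + r * (ε / (4 * d)) := by field_simp; ring
    rw [e2, add_mul, e1]
    linarith
  have hbad := S.measureReal_lt_norm_gradEstimate_sub_le hm hp D hbound hr0 hB hP
    (by positivity) hη (by positivity) hηs hN0
  have hscale : (m : ℝ) * p * (2 * (ε / (2 * d))) = ε := by
    rw [← hd]; field_simp
  rw [hscale] at hbad
  have hsmall : d * (2 * Real.exp (-(N * (ε / (2 * d)) ^ 2 /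
      (2 * ((L₂ + 1) * P ^ 2 * q / r) ^ 2)))) < δ :=
    OutputFeedback.mul_two_mul_exp_neg_lt hε hδ hd1 hq2 hc (by positivity) hcr hN
  have hbad := hbad.trans_lt hsmall
  have : MeasureTheory.IsProbabilityMeasure (OutputFeedback.sampleLaw m p D N) := by
    unfold OutputFeedback.sampleLaw; infer_instance
  have htotal : 1 ≤ (OutputFeedback.sampleLaw m p D N).real
      {ω | ‖S.gradEstimate r τ K ω - g‖ ≤ ε} +
      (OutputFeedback.sampleLaw m p D N).real {ω | ε < ‖S.gradEstimate r τ K ω - g‖} := by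
    refine le_trans ?_ (MeasureTheory.measureReal_union_le _ _)
    rw [← MeasureTheory.probReal_univ (μ := OutputFeedback.sampleLaw m p D N)]
    refine MeasureTheory.measureReal_mono fun ω _ => ?_
    rcases le_or_gt ‖S.gradEstimate r τ K ω - g‖ ε with h | h
    · exact Or.inl h
    · exact Or.inr h
  linarith
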